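/- Let $n\ge 2$ and let $u\in S^{n-1}$. For a bounded, compactly supported Borel function $g:\mathbb{R}^n\to[0,\infty)$, let $I(g)\subset\mathbb{R}^n$ be the star-shaped set $\{r\theta:\theta\in S^{n-1},\ 0\le r\le\rho_{I(g)}(\theta)\}$ with radial function $\rho_{I(g)}(\theta)=\int_{\theta^\perp}g(y)\,dy$, and for a compact set $K\subset\mathbb{R}^n$ let $IK$ be the star-shaped set with radial function $\rho_{IK}(\theta)=|K\cap\theta^\perp|_{n-1}$ (so $IK=I(1_K)$); here $|\cdot|_k$ is $k$-dimensional Hausdorff measure, normalized to agree with Lebesgue measure, and $|\cdot|=|\cdot|_n$. For compact $K$ let $S_uK$ be its Steiner symmetral: for each $y\in u^\perp$ with $K\cap(y+\mathbb{R}u)\neq\emptyset$, $$S_uK\cap(y+\mathbb{R}u)=y+[-\ell_y,\ell_y]\,u,\qquad \ell_y=\tfrac12\,|K\cap(y+\mathbb{R}u)|_1,$$ and $S_uK\cap(y+\mathbb{R}u)=\emptyset$ for all other $y\in u^\perp$. For an upper semicontinuous, compactly supported $f:\mathbb{R}^n\to[0,\infty)$ let $S_uf(x)=\int_0^\infty 1_{S_u\{f\ge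 t\}}(x)\,dt$. Then $|I(f)|\le|I(S_uf)|$ for every upper semicontinuous, compactly supported $f:\mathbb{R}^n\to[0,\infty)$ (in particular for every continuous one), and $|IK|\le|I(S_uK)|$ for every compact set $K\subset\mathbb{R}^n$. -/

import Mathlib

open MeasureTheory Set

open scoped RealInnerProductSpace

noncomputable section

namespace BusemannSteiner

/-- The hyperplane `θ^⊥` through the origin, as a subset of `ℝⁿ`. -/
def hyperplane {n : ℕ} (θ : EuclideanSpace ℝ (Fin n)) : Set (EuclideanSpace ℝ (Fin n)) :=
  {y | ⟪θ, y⟫ = 0}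

/-- The star-shaped set `{r θ : r ∈ [0, ρ θ], θ ∈ S^{n-1}}` with radial function `ρ`
(only the values of `ρ` on the unit sphere matter). -/
def starShaped {n : ℕ} (ρ : EuclideanSpace ℝ (Fin n) → ℝ) : Set (EuclideanSpace ℝ (Fin n)) :=
  {x | ∃ θ : EuclideanSpace ℝ (Fin n), ‖θ‖ = 1 ∧ ∃ r ∈ Icc (0 : ℝ) (ρ θ), x = r • θ}

/-- The intersection body `I(K)` of a bounded Borel set: the star-shaped set with radial function
`θ ↦ |K ∩ θ^⊥|_{n-1}`. Here `μHE[n - 1]` is the `(n-1)`-dimensional Hausdorff measure on `ℝⁿ`,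
normalized to agree with Lebesgue measure on hyperplanes. -/
def intersectionBody {n : ℕ} (K : Set (EuclideanSpace ℝ (Fin n))) :
    Set (EuclideanSpace ℝ (Fin n)) :=
  starShaped fun θ => (μHE[n - 1] (K ∩ hyperplane θ)).toReal

/-- The intersection body `I(g)` of a bounded, compactly supported, nonnegative Borel function:
the star-shaped set with radial function `θ ↦ ∫_{θ^⊥} g(y) dy`. -/
def intersectionBodyFun {n : ℕ} (g : EuclideanSpace ℝ (Fin n) → ℝ) :
    Set (EuclideanSpace ℝ (Fin n)) :=
  starShaped fun θ => ∫ y in hyperplane θ, g y ∂μHE[n - 1]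

/-- The fiber of `K` over `y` in direction `u`, in the coordinate `s ↦ y + s u` (an isometric
parametrization of the line `y + ℝ u` when `u` is a unit vector). -/
def fiber {n : ℕ} (u : EuclideanSpace ℝ (Fin n)) (K : Set (EuclideanSpace ℝ (Fin n)))
    (y : EuclideanSpace ℝ (Fin n)) : Set ℝ :=
  {s | y + s • u ∈ K}

/-- The Steiner symmetral `S_u K` of a compact set `K` (`u` a unit vector): for each `y ∈ u^⊥`
whose fiber is nonempty (that is, each `y` in the orthogonal projection of `K` onto `u^⊥`), the
fiber is replaced by `y + [-ℓ, ℓ] u`, where `2 ℓ` is the length of the fiber; the other fibers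
stay empty. -/
def steiner {n : ℕ} (u : EuclideanSpace ℝ (Fin n)) (K : Set (EuclideanSpace ℝ (Fin n))) :
    Set (EuclideanSpace ℝ (Fin n)) :=
  {x | ∃ y ∈ hyperplane u, (fiber u K y).Nonempty ∧
    ∃ s : ℝ, |s| ≤ (volume (fiber u K y)).toReal / 2 ∧ x = y + s • u}

/-- The Steiner symmetral of a nonnegative, upper semicontinuous, compactly supported function,
through the layer-cake formula `S_u f(x) = ∫_0^∞ 1_{S_u {f ≥ t}}(x) dt`. -/
def steinerFun {n : ℕ} (u : EuclideanSpace ℝ (Fin n)) (f : EuclideanSpace ℝ (Fin n) → ℝ) :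
    EuclideanSpace ℝ (Fin n) → ℝ :=
  fun x => ∫ t in Ioi (0 : ℝ), (steiner u {z | t ≤ f z}).indicator (fun _ => (1 : ℝ)) x

end BusemannSteiner

end

/-! Write n = d + 1 and x = B y + s u with y in ℝ^d, where B parametrizes u^⊥. A hyperplane not
containing u is a graph s = ⟪w, y⟫, and the integral of f over it is √(1 + ‖w‖²) J(w), with J(w) = ∫
f(B y + ⟪w, y⟫ u) dy. The same square root is the length of the normal u - B w. Hence, for s ≠ 0, B
z + s u lies in I(f) exactly when |s| ≤ J(-z/s), and integration gives |I(f)| = c_d ∫ J(w)^(d+1) dw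
(`IsFrame.volume_intersectionBodyFun`).

Expanding the power gives an integral over d + 1 points Y_1, …, Y_d, y; the inner integral over w is
of a product of fibre functions of f at the numbers ⟪w, Y_i⟫ and ⟪w, y⟫. For almost every choice of
points, s_i = ⟪w, Y_i⟫ are linear coordinates of w and ⟪w, y⟫ = ∑ c_i s_i with every c_i ≠ 0.
Steiner symmetrization rearranges each fibre function, so the Rogers–Brascamp–Lieb–Luttinger
inequality (`lintegral_prod_mul_le`) compares the inner integrals for almost all points.

That inequality is obtained one variable at a time: the relation `RearrDom` survives convolution
(`RearrDom.convolution`). Its core is a Riesz-type inequality on the line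
(`RearrDom.lintegral_sub`), proved by parametrizing two sets increasingly by their own length.
Compact sets are the case f = 1_K. -/

open scoped ENNReal

noncomputable section

namespace BusemannSteiner

/-! ### Increasing parametrizations of sets of finite length -/

/-- A measurable quantile function of a set of finite length. -/
theorem exists_quantile {A : Set ℝ} (hfin : volume A ≠ ∞) :
    ∃ q : ℝ → ℝ, Measurable q ∧ StrictMonoOn q (Ioo 0 (volume.real A)) ∧
      (volume.restrict (Ioo 0 (volume.real A))).map q = volume.restrict A := by
  set a := volume.real A with ha
  have : IsFiniteMeasure (volume.restrict A) := ⟨by simpa using hfin.lt_top⟩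
  set μ : Measure ℝ := volume.restrict A with hμ
  have hμu : μ.real univ = a := by simp [hμ, ha, measureReal_def]
  set m : ℝ → ℝ := fun v => μ.real (Iic v) with hm
  have mono : Monotone m := fun u v h => measureReal_mono (Iic_subset_Iic.2 h)
  have lip : ∀ u v, u ≤ v → m v - m u ≤ v - u := by
    intro u v h
    have h1 : μ.real (Iic v) ≤ μ.real (Iic u) + μ.real (Ioc u v) := by
      rw [← Iic_union_Ioc_eq_Iic h]; exact measureReal_union_le _ _
    have h2 : μ.real (Ioc u v) ≤ v - u := by
      rw [measureReal_def]
      refine ENNReal.toReal_le_of_le_ofReal (by linarith) ?_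
      rw [← Real.volume_Ioc]
      exact Measure.restrict_apply_le _ _
    simp only [hm]; linarith
  have lip' : LipschitzWith 1 m := by
    refine LipschitzWith.of_le_add fun x y => ?_
    rcases le_total x y with h | h
    · have := mono h; have := dist_nonneg (x := x) (y := y); linarith
    · have := lip y x h; rw [Real.dist_eq, abs_of_nonneg (by linarith)]; linarith
  have cont := lip'.continuous
  have top : Filter.Tendsto m Filter.atTop (nhds a) := by
    rw [← hμu]
    exact (ENNReal.tendsto_toReal (measure_ne_top _ _)).comp (tendsto_measure_Iic_atTop μ)
  have bot : Filter.Tendsto m Filter.atBot (nhds 0) := by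
    have h := tendsto_measure_iInter_atBot (μ := μ) (s := fun v : ℝ => Iic v)
      (fun v => measurableSet_Iic.nullMeasurableSet) (fun u v h => Iic_subset_Iic.2 h)
      ⟨0, measure_ne_top _ _⟩
    have h0 : (⋂ v : ℝ, Iic v) = ∅ := by
      ext x; simp only [mem_iInter, mem_Iic, mem_empty_iff_false, iff_false, not_forall, not_le]
      exact ⟨x - 1, by linarith⟩
    rw [h0, measure_empty] at h
    exact (ENNReal.tendsto_toReal ENNReal.zero_ne_top).comp h
  have mle : ∀ v, m v ≤ a := fun v => by rw [← hμu]; exact measureReal_mono (subset_univ _)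
  -- The generalized inverse of the distribution function `m`. Continuity of `m` gives m(p(s)) = s
  -- on (0, a), hence strict monotonicity.
  set p : ℝ → ℝ := fun s => sInf {v | s ≤ m v} with hp
  have gal : ∀ s ∈ Ioo 0 a, ∀ v, p s ≤ v ↔ s ≤ m v := by
    intro s hs v
    have hne : {v | s ≤ m v}.Nonempty := (top.eventually (lt_mem_nhds hs.2)).exists.imp
      fun v hv => le_of_lt hv
    have hbd : BddBelow {v | s ≤ m v} := by
      obtain ⟨u, hu⟩ := (bot.eventually (gt_mem_nhds hs.1)).exists
      refine ⟨u, fun v hv => ?_⟩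
      by_contra hlt
      exact absurd (mono (not_le.1 hlt).le) (not_le.2 (lt_of_lt_of_le hu hv))
    have hcl : IsClosed {v | s ≤ m v} := isClosed_le continuous_const cont
    constructor
    · intro h
      exact (show s ≤ m (p s) from hcl.csInf_mem hne hbd).trans (mono h)
    · intro h
      exact csInf_le hbd h
  have mp : ∀ s ∈ Ioo 0 a, m (p s) ≤ s := by
    intro s hs
    refine le_of_tendsto (cont.continuousWithinAt (s := Iio (p s))) ?_
    filter_upwards [self_mem_nhdsWithin] with v hv
    exact (lt_of_not_ge fun h => absurd ((gal s hs v).2 h) (not_le.2 hv)).le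
  -- Outside (0, a) the set defining `p` may be empty or unbounded below, so the value 0 is imposed
  -- there.
  set q : ℝ → ℝ := (Ioo 0 a).indicator p with hq
  have qmeas : Measurable q := by
    refine measurable_of_Iic fun v => ?_
    have : q ⁻¹' Iic v = (Ioo 0 a ∩ Iic (m v)) ∪ ((Ioo 0 a)ᶜ ∩ {_s | 0 ≤ v}) := by
      ext s
      by_cases hs : s ∈ Ioo 0 a
      · simp only [hq, mem_preimage, indicator_of_mem hs, mem_Iic, gal s hs]
        simp [hs]
      · simp only [hq, mem_preimage, indicator_of_notMem hs, mem_Iic]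
        simp [hs]
    rw [this]
    exact (measurableSet_Ioo.inter measurableSet_Iic).union
      (measurableSet_Ioo.compl.inter (MeasurableSet.const _))
  refine ⟨q, qmeas, ?_, ?_⟩
  · intro s hs t ht hst
    simp only [hq, indicator_of_mem hs, indicator_of_mem ht]
    refine lt_of_not_ge fun h => ?_
    have := (gal t ht _).1 h
    linarith [mp s hs]
  · symm
    refine Measure.ext_of_Iic _ _ fun v => ?_
    rw [Measure.map_apply qmeas measurableSet_Iic, Measure.restrict_apply (qmeas measurableSet_Iic)]
    have h1 : q ⁻¹' Iic v ∩ Ioo 0 a = Ioo 0 a ∩ Iic (m v) := by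
      ext s
      simp only [mem_inter_iff, mem_preimage, mem_Iic]
      constructor
      · rintro ⟨h, hs⟩
        rw [hq, indicator_of_mem hs, gal s hs] at h
        exact ⟨hs, h⟩
      · rintro ⟨hs, h⟩
        rw [hq, indicator_of_mem hs, gal s hs]
        exact ⟨h, hs⟩
    have h2 : μ (Iic v) = ENNReal.ofReal (m v) := by
      rw [hm, ofReal_measureReal]
    rw [h1, h2]
    refine le_antisymm ?_ ?_
    · calc ENNReal.ofReal (m v) = volume (Ioo 0 (m v)) := by simp
        _ ≤ volume (Ioo 0 a ∩ Iic (m v)) :=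
          measure_mono fun s hs => ⟨⟨hs.1, hs.2.trans_le (mle v)⟩, hs.2.le⟩
    · calc volume (Ioo 0 a ∩ Iic (m v)) ≤ volume (Icc 0 (m v)) := measure_mono fun s hs => ⟨hs.1.1.le, hs.2⟩
        _ = _ := by simp

theorem lintegral_quantile_Ioo {A : Set ℝ} {q : ℝ → ℝ} (hq : Measurable q)
    (hmono : StrictMonoOn q (Ioo 0 (volume.real A)))
    (hmap : (volume.restrict (Ioo 0 (volume.real A))).map q = volume.restrict A)
    {s : ℝ} (hs : s ∈ Ioo 0 (volume.real A)) {h : ℝ → ℝ≥0∞} (hh : Measurable h) :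
    ∫⁻ t in Ioo s (volume.real A), h (q t) = ∫⁻ v in A ∩ Ioi (q s), h v := by
  rw [inter_comm, ← Measure.restrict_restrict measurableSet_Ioi, ← lintegral_indicator
    measurableSet_Ioi, ← hmap, lintegral_map (hh.indicator measurableSet_Ioi) hq,
    ← lintegral_indicator measurableSet_Ioo, ← lintegral_indicator measurableSet_Ioo]
  congr 1 with t
  by_cases ht : t ∈ Ioo 0 (volume.real A)
  · have : q s < q t ↔ s < t := hmono.lt_iff_lt hs ht
    simp [indicator, ht.1, ht.2, this]
  · have : t ∉ Ioo s (volume.real A) := fun h => ht ⟨hs.1.trans h.1, h.2⟩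
    rw [indicator_of_notMem this, indicator_of_notMem ht]

/-- Decompose an integral over a rectangle according to the smaller of the two variables. -/
theorem lintegral_rectangle_cut {H : ℝ → ℝ → ℝ≥0∞} (hH : Measurable (Function.uncurry H))
    (a b : ℝ) :
    ∫⁻ s in Ioo 0 a, ∫⁻ t in Ioo 0 b, H s t =
      ∫⁻ s in Ioo 0 (min a b), ((∫⁻ t in Ioo s b, H s t) + ∫⁻ t in Ioo s a, H t s) := by
  set P : ℝ → ℝ → ℝ≥0∞ := fun s t =>
    {p : ℝ × ℝ | 0 < p.1 ∧ p.1 < a ∧ p.1 < p.2 ∧ p.2 < b}.indicator (Function.uncurry H) (s, t)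
    with hP
  set Q : ℝ → ℝ → ℝ≥0∞ := fun s t =>
    {p : ℝ × ℝ | 0 < p.2 ∧ p.2 < b ∧ p.2 < p.1 ∧ p.1 < a}.indicator (Function.uncurry H) (s, t)
    with hQ
  have mP : Measurable (Function.uncurry P) := by
    refine hH.indicator ?_
    refine (measurableSet_lt measurable_const measurable_fst).inter
      ((measurableSet_lt measurable_fst measurable_const).inter
      ((measurableSet_lt measurable_fst measurable_snd).inter
      (measurableSet_lt measurable_snd measurable_const)))
  have mQ : Measurable (Function.uncurry Q) := by
    refine hH.indicator ?_
    refine (measurableSet_lt measurable_const measurable_snd).inter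
      ((measurableSet_lt measurable_snd measurable_const).inter
      ((measurableSet_lt measurable_snd measurable_fst).inter
      (measurableSet_lt measurable_fst measurable_const)))
  have L : ∫⁻ s in Ioo 0 a, ∫⁻ t in Ioo 0 b, H s t = ∫⁻ s, ∫⁻ t, (P s t + Q s t) := by
    rw [← lintegral_indicator measurableSet_Ioo]
    congr 1 with s
    by_cases hs : s ∈ Ioo 0 a
    · rw [indicator_of_mem hs, ← lintegral_indicator measurableSet_Ioo]
      -- The two triangles miss only the diagonal t = s, which is null.
      refine lintegral_congr_ae ?_
      filter_upwards [compl_mem_ae_iff.2 (measure_singleton s)] with t ht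
      have hne : t ≠ s := ht
      rcases lt_or_gt_of_ne hne with h | h
      · by_cases h0 : 0 < t
        · simp [P, Q, indicator, h, h.not_gt, h0, hs.1, hs.2]
        · simp [P, Q, indicator, h.not_gt, h0]
      · have h0 := hs.1.trans h
        simp [P, Q, indicator, h, h.not_gt, h0, hs.1, hs.2]
    · rw [indicator_of_notMem hs]
      have h0 : ∀ t, P s t + Q s t = 0 := by
        intro t
        have h1 : ¬ (0 < s ∧ s < a ∧ s < t ∧ t < b) := fun h => hs ⟨h.1, h.2.1⟩
        have h2 : ¬ (0 < t ∧ t < b ∧ t < s ∧ s < a) := fun h => hs ⟨h.1.trans h.2.2.1, h.2.2.2⟩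
        simp [P, Q, indicator, h1, h2]
      simp_rw [h0, lintegral_zero]
  rw [L]
  have e1 : ∫⁻ s, ∫⁻ t, (P s t + Q s t) = ∫⁻ s, ((∫⁻ t, P s t) + ∫⁻ t, Q t s) := by
    have : ∀ s, ∫⁻ t, (P s t + Q s t) = (∫⁻ t, P s t) + ∫⁻ t, Q s t := fun s =>
      lintegral_add_left (mP.comp measurable_prodMk_left) _
    simp_rw [this]
    have mP' : Measurable fun s => ∫⁻ t, P s t := mP.lintegral_prod_right
    rw [lintegral_add_left mP', lintegral_add_left mP',
      lintegral_lintegral_swap (f := Q) mQ.aemeasurable]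
  rw [e1, ← lintegral_indicator measurableSet_Ioo]
  congr 1 with s
  by_cases h0 : 0 < s
  · have k1 : ∫⁻ t, P s t = if s < a then ∫⁻ t in Ioo s b, H s t else 0 := by
      split_ifs with h
      · rw [← lintegral_indicator measurableSet_Ioo]
        congr 1 with t
        simp [P, indicator, h0, h]
      · simp [P, indicator, h]
    have k2 : ∫⁻ t, Q t s = if s < b then ∫⁻ t in Ioo s a, H t s else 0 := by
      split_ifs with h
      · rw [← lintegral_indicator measurableSet_Ioo]
        congr 1 with t
        simp [Q, indicator, h0, h]
      · simp [Q, indicator, h]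
    rw [k1, k2]
    by_cases ha : s < a <;> by_cases hb : s < b
    · simp [indicator, h0, ha, hb]
    · simp [indicator, ha, hb]
    · simp [indicator, ha, hb]
    · simp [indicator, ha, hb]
  · simp [P, Q, indicator, h0]

/-! ### A Riesz-type rearrangement inequality on the line -/

/-- The open interval of length `a` centred at the origin. -/
def centred (a : ℝ) : Set ℝ := Ioo (-(a / 2)) (a / 2)

theorem measurableSet_centred (a : ℝ) : MeasurableSet (centred a) := measurableSet_Ioo

theorem volume_centred (a : ℝ) : volume (centred a) = ENNReal.ofReal a := by
  rw [centred, Real.volume_Ioo]; congr 1; ring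

/-- `g'` dominates the symmetric decreasing rearrangement of `g` in the sense of the integrals
over centred intervals. -/
def RearrDom (g g' : ℝ → ℝ≥0∞) : Prop :=
  ∀ E : Set ℝ, MeasurableSet E → volume E ≠ ∞ →
    ∫⁻ x in E, g x ≤ ∫⁻ x in centred (volume.real E), g' x

theorem lintegral_centred (a : ℝ) {φ : ℝ → ℝ≥0∞} (hφ : Measurable φ) :
    ∫⁻ z in centred a, φ z = ∫⁻ s in Ioo 0 a, φ (s - a / 2) := by
  rw [← (measurePreserving_sub_right volume (a / 2)).setLIntegral_comp_preimage
    (measurableSet_centred a) hφ]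
  congr 2
  ext x
  simp only [centred, mem_preimage, mem_Ioo]
  constructor <;> rintro ⟨h1, h2⟩ <;> constructor <;> linarith

/-- Parametrize D and A by quantiles x and y and cut the parameter rectangle into hooks with corner
(s, s). Along a hook the differences y(t) - x(s) and y(s) - x(t), t > s, lie on opposite sides of
y(s) - x(s), so they sweep disjoint sets of total length a + b - 2s. For centred intervals the same
hook sweeps the centred interval of that length, up to one point. The hypothesis on g, g' then
compares hook by hook. -/
theorem RearrDom.lintegral_sub {g g' : ℝ → ℝ≥0∞} (hg : Measurable g) (hg' : Measurable g')
    (h : RearrDom g g') {D A : Set ℝ} (hD : MeasurableSet D) (hA : MeasurableSet A)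
    (hD' : volume D ≠ ∞) (hA' : volume A ≠ ∞) :
    ∫⁻ z in D, ∫⁻ s in A, g (s - z) ≤
      ∫⁻ z in centred (volume.real D), ∫⁻ s in centred (volume.real A), g' (s - z) := by
  obtain ⟨x, hx, xmono, xmap⟩ := exists_quantile hD'
  obtain ⟨y, hy, ymono, ymap⟩ := exists_quantile hA'
  have xcut := @lintegral_quantile_Ioo D x hx xmono xmap
  have ycut := @lintegral_quantile_Ioo A y hy ymono ymap
  set a := volume.real D with ha
  set b := volume.real A with hb
  have m1 : Measurable fun p : ℝ × ℝ => g (p.2 - p.1) := by fun_prop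
  have m2 : Measurable fun p : ℝ × ℝ => g' (p.2 - p.1) := by fun_prop
  have L : ∫⁻ z in D, ∫⁻ s in A, g (s - z) =
      ∫⁻ s in Ioo 0 a, ∫⁻ t in Ioo 0 b, g (y t - x s) := by
    rw [← xmap, lintegral_map m1.lintegral_prod_right' hx]
    refine lintegral_congr fun s => ?_
    rw [← ymap, lintegral_map (by fun_prop) hy]
  have R : ∫⁻ z in centred a, ∫⁻ s in centred b, g' (s - z) =
      ∫⁻ s in Ioo 0 a, ∫⁻ t in Ioo 0 b, g' ((t - b / 2) - (s - a / 2)) := by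
    rw [lintegral_centred a m2.lintegral_prod_right']
    refine lintegral_congr fun s => ?_
    rw [lintegral_centred b (by fun_prop)]
  rw [L, R, lintegral_rectangle_cut (by unfold Function.uncurry; fun_prop),
    lintegral_rectangle_cut (by unfold Function.uncurry; fun_prop)]
  refine setLIntegral_mono' measurableSet_Ioo fun s hs => ?_
  have hsa : s ∈ Ioo 0 a := ⟨hs.1, hs.2.trans_le (min_le_left _ _)⟩
  have hsb : s ∈ Ioo 0 b := ⟨hs.1, hs.2.trans_le (min_le_right _ _)⟩
  set E₁ : Set ℝ := (fun w => w + x s) ⁻¹' (A ∩ Ioi (y s)) with hE₁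
  set E₂ : Set ℝ := (fun w => y s - w) ⁻¹' (D ∩ Ioi (x s)) with hE₂
  have mE₁ : MeasurableSet E₁ := (hA.inter measurableSet_Ioi).preimage (by fun_prop)
  have mE₂ : MeasurableSet E₂ := (hD.inter measurableSet_Ioi).preimage (by fun_prop)
  have i₁ : ∫⁻ t in Ioo s b, g (y t - x s) = ∫⁻ w in E₁, g w := by
    have := (measurePreserving_add_right volume (x s)).setLIntegral_comp_preimage
      (hA.inter (measurableSet_Ioi (a := y s))) (f := fun v => g (v - x s)) (by fun_prop)
    rw [ycut hsb (h := fun v => g (v - x s)) (by fun_prop), ← this]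
    simp only [add_sub_cancel_right, hE₁]
  have i₂ : ∫⁻ t in Ioo s a, g (y s - x t) = ∫⁻ w in E₂, g w := by
    have := (Measure.measurePreserving_sub_left volume (y s)).setLIntegral_comp_preimage
      (hD.inter (measurableSet_Ioi (a := x s))) (f := fun v => g (y s - v)) (by fun_prop)
    rw [xcut hsa (h := fun v => g (y s - v)) (by fun_prop), ← this]
    simp only [sub_sub_cancel, hE₂]
  have v₁ : volume E₁ = ENNReal.ofReal (b - s) := by
    have := (measurePreserving_add_right volume (x s)).measure_preimage
      (hA.inter (measurableSet_Ioi (a := y s))).nullMeasurableSet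
    rw [hE₁, this, ← setLIntegral_one, ← ycut hsb measurable_const, setLIntegral_one,
      Real.volume_Ioo]
  have v₂ : volume E₂ = ENNReal.ofReal (a - s) := by
    have := (Measure.measurePreserving_sub_left volume (y s)).measure_preimage
      (hD.inter (measurableSet_Ioi (a := x s))).nullMeasurableSet
    rw [hE₂, this, ← setLIntegral_one, ← xcut hsa measurable_const, setLIntegral_one,
      Real.volume_Ioo]
  have disj : Disjoint E₁ E₂ := by
    rw [Set.disjoint_left]
    rintro w ⟨-, h1⟩ ⟨-, h2⟩
    simp only [mem_Ioi] at h1 h2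
    linarith
  have vE : volume (E₁ ∪ E₂) = ENNReal.ofReal (a + b - 2 * s) := by
    rw [measure_union disj mE₂, v₁, v₂, ← ENNReal.ofReal_add (by linarith [hsb.2])
      (by linarith [hsa.2])]
    congr 1; ring
  have vE' : volume.real (E₁ ∪ E₂) = a + b - 2 * s := by
    rw [measureReal_def, vE, ENNReal.toReal_ofReal (by linarith [hsa.2, hsb.2])]
  rw [i₁, i₂, ← lintegral_union mE₂ disj]
  refine (h _ (mE₁.union mE₂) (by rw [vE]; exact ENNReal.ofReal_ne_top)).trans ?_
  rw [vE']
  -- The left endpoint is included so that this interval and that of `j₂` together cover the corner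
  -- value (a - b) / 2.
  have j₁ : ∫⁻ t in Ioo s b, g' ((t - b / 2) - (s - a / 2)) =
      ∫⁻ w in Ico ((a - b) / 2) ((a + b) / 2 - s), g' w := by
    rw [← setLIntegral_congr (Ioo_ae_eq_Ico (μ := volume)),
      ← (measurePreserving_sub_right volume (b / 2 + (s - a / 2))).setLIntegral_comp_preimage
      measurableSet_Ioo hg', preimage_sub_const_Ioo]
    congr 2
    · congr 1 <;> ring
    · ext t; congr 1; ring
  have j₂ : ∫⁻ t in Ioo s a, g' ((s - b / 2) - (t - a / 2)) =
      ∫⁻ w in Ioo (s - (a + b) / 2) ((a - b) / 2), g' w := by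
    rw [← (Measure.measurePreserving_sub_left volume (s - b / 2 + a / 2)).setLIntegral_comp_preimage
      measurableSet_Ioo hg', preimage_const_sub_Ioo]
    congr 2
    · congr 1 <;> ring
    · ext t; congr 1; ring
  rw [j₁, j₂]
  refine le_trans (lintegral_mono_set fun w hw => ?_) (lintegral_union_le _ _ _)
  rcases lt_or_ge w ((a - b) / 2) with hlt | hge
  · exact Or.inr ⟨by have := hw.1; linarith, hlt⟩
  · exact Or.inl ⟨hge, by have := hw.2; linarith⟩

theorem lintegral_comp_mul_left {c : ℝ} (hc : c ≠ 0) {G : ℝ → ℝ≥0∞} (hG : Measurable G)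
    {E : Set ℝ} (hE : MeasurableSet E) :
    ∫⁻ x in E, G (c * x) =
      ENNReal.ofReal |c⁻¹| * ∫⁻ x in (fun x => c⁻¹ * x) ⁻¹' E, G x := by
  have hE' : MeasurableSet ((fun x => c⁻¹ * x) ⁻¹' E) := hE.preimage (by fun_prop)
  rw [← lintegral_indicator hE', ← smul_eq_mul, ← lintegral_smul_measure,
    ← Real.map_volume_mul_left hc, lintegral_map (hG.indicator hE') (by fun_prop),
    ← lintegral_indicator hE]
  congr 1 with x
  have : c * x ∈ (fun x => c⁻¹ * x) ⁻¹' E ↔ x ∈ E := by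
    rw [mem_preimage, inv_mul_cancel_left₀ hc]
  by_cases hx : x ∈ E
  · rw [indicator_of_mem hx, indicator_of_mem (this.2 hx)]
  · rw [indicator_of_notMem hx, indicator_of_notMem (mt this.1 hx)]

/-- Dilations and reflection carry centred intervals to centred intervals and multiply all lengths
by the same factor. -/
theorem RearrDom.comp_mul_left {g g' : ℝ → ℝ≥0∞} (hg : Measurable g) (hg' : Measurable g')
    (h : RearrDom g g') {c : ℝ} (hc : c ≠ 0) :
    RearrDom (fun x => g (c * x)) fun x => g' (c * x) := by
  intro E hE hfin
  have hE' : MeasurableSet ((fun x => c⁻¹ * x) ⁻¹' E) := hE.preimage (by fun_prop)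
  have vol : volume ((fun x => c⁻¹ * x) ⁻¹' E) = ENNReal.ofReal |c| * volume E := by
    have := Real.volume_preimage_mul_left (inv_ne_zero hc) E
    rwa [inv_inv] at this
  have vol' : volume.real ((fun x => c⁻¹ * x) ⁻¹' E) = |c| * volume.real E := by
    rw [measureReal_def, vol, ENNReal.toReal_mul, ENNReal.toReal_ofReal (abs_nonneg _),
      measureReal_def]
  rw [lintegral_comp_mul_left hc hg hE, lintegral_comp_mul_left hc hg' (measurableSet_centred _)]
  refine mul_le_mul_right ?_ _
  refine (h _ hE' (by rw [vol]; exact ENNReal.mul_ne_top ENNReal.ofReal_ne_top hfin)).trans_eq ?_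
  rw [vol']
  congr 2
  ext x
  have hc' : 0 < |c| := abs_pos.2 hc
  simp only [centred, mem_preimage, mem_Ioo]
  rw [← abs_lt, ← abs_lt, abs_mul, abs_inv, inv_mul_lt_iff₀ hc',
    mul_div_assoc]

theorem lintegral_fin_cons {X : Type*} [MeasureSpace X] [SigmaFinite (volume : Measure X)] {m : ℕ}
    {φ : (Fin (m + 1) → X) → ℝ≥0∞} (hφ : Measurable φ) :
    ∫⁻ s, φ s = ∫⁻ x : X, ∫⁻ s : Fin m → X, φ (Fin.cons x s) := by
  have e := (volume_preserving_piFinSuccAbove (fun _ : Fin (m + 1) => X) 0).symm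
  rw [← e.lintegral_comp hφ]
  have hm : Measurable fun p : X × (Fin m → X) =>
      φ ((MeasurableEquiv.piFinSuccAbove (fun _ : Fin (m + 1) => X) 0).symm p) :=
    hφ.comp (MeasurableEquiv.measurable _)
  rw [Measure.volume_eq_prod, lintegral_prod _ hm.aemeasurable]
  simp [MeasurableEquiv.piFinSuccAbove, Fin.insertNthEquiv]

/-! ### Layer-cake pairs and the Rogers–Brascamp–Lieb–Luttinger inequality -/

/-- `F` is a superposition of indicators of sets of finite length, and `F'` dominates the
superposition of the indicators of the centred intervals of the same lengths. -/
def LayerPair (F F' : ℝ → ℝ≥0∞) : Prop :=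
  ∃ S : ℝ → Set ℝ, MeasurableSet {p : ℝ × ℝ | p.2 ∈ S p.1} ∧ (∀ t > 0, volume (S t) ≠ ∞) ∧
    (∀ s, F s = ∫⁻ t in Ioi (0 : ℝ), (S t).indicator 1 s) ∧
    ∀ s, ∫⁻ t in Ioi (0 : ℝ), (centred (volume.real (S t))).indicator 1 s ≤ F' s

theorem measurable_indicator_layer {S : ℝ → Set ℝ}
    (hS : MeasurableSet {p : ℝ × ℝ | p.2 ∈ S p.1}) :
    Measurable fun p : ℝ × ℝ => (S p.1).indicator (1 : ℝ → ℝ≥0∞) p.2 :=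
  (measurable_const (a := (1 : ℝ≥0∞))).indicator hS

theorem measurableSet_slice {S : ℝ → Set ℝ}
    (hS : MeasurableSet {p : ℝ × ℝ | p.2 ∈ S p.1}) (t : ℝ) : MeasurableSet (S t) :=
  measurable_prodMk_left hS

theorem measurableSet_centred_layer {S : ℝ → Set ℝ}
    (hS : MeasurableSet {p : ℝ × ℝ | p.2 ∈ S p.1}) :
    MeasurableSet {p : ℝ × ℝ | p.2 ∈ centred (volume.real (S p.1))} := by
  have h : Measurable fun t => volume.real (S t) :=
    (measurable_measure_prodMk_left hS).ennreal_toReal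
  have h1 : Measurable fun p : ℝ × ℝ => volume.real (S p.1) / 2 :=
    (h.comp measurable_fst).div_const _
  exact (measurableSet_lt h1.neg measurable_snd).inter (measurableSet_lt measurable_snd h1)

theorem lintegral_layer_mul {S : ℝ → Set ℝ} (hS : MeasurableSet {p : ℝ × ℝ | p.2 ∈ S p.1})
    {G : ℝ → ℝ≥0∞} (hG : Measurable G) :
    ∫⁻ s, (∫⁻ t in Ioi (0 : ℝ), (S t).indicator 1 s) * G s =
      ∫⁻ t in Ioi (0 : ℝ), ∫⁻ s in S t, G s := by
  have hm := measurable_indicator_layer hS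
  have h1 : ∀ s, (∫⁻ t in Ioi (0 : ℝ), (S t).indicator 1 s) * G s =
      ∫⁻ t in Ioi (0 : ℝ), (S t).indicator 1 s * G s := fun s =>
    (lintegral_mul_const _ (hm.comp measurable_prodMk_right)).symm
  simp_rw [h1]
  rw [lintegral_lintegral_swap]
  · refine lintegral_congr fun t => ?_
    rw [← lintegral_indicator (measurableSet_slice hS t)]
    congr 1 with s
    by_cases hs : s ∈ S t <;> simp [hs]
  · exact ((hm.comp measurable_swap).mul (hG.comp measurable_fst)).aemeasurable

theorem LayerPair.measurable {F F' : ℝ → ℝ≥0∞} (h : LayerPair F F') : Measurable F := by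
  obtain ⟨S, hS, -, hF, -⟩ := h
  have : F = fun s => ∫⁻ t in Ioi (0 : ℝ), (S t).indicator 1 s := funext hF
  rw [this]
  exact (measurable_indicator_layer hS).lintegral_prod_left'

theorem LayerPair.lintegral_mul_le {F F' G G' : ℝ → ℝ≥0∞} (h : LayerPair F F')
    (hG : Measurable G) (hG' : Measurable G') (hd : RearrDom G G') :
    ∫⁻ s, F s * G s ≤ ∫⁻ s, F' s * G' s := by
  obtain ⟨S, hS, hfin, hF, hF'⟩ := h
  simp_rw [hF]
  rw [lintegral_layer_mul hS hG]
  calc ∫⁻ t in Ioi (0 : ℝ), ∫⁻ s in S t, G s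
      ≤ ∫⁻ t in Ioi (0 : ℝ), ∫⁻ s in centred (volume.real (S t)), G' s :=
        setLIntegral_mono' measurableSet_Ioi fun t ht =>
          hd _ (measurableSet_slice hS t) (hfin t ht)
    _ = ∫⁻ s, (∫⁻ t in Ioi (0 : ℝ), (centred (volume.real (S t))).indicator 1 s) * G' s :=
        (lintegral_layer_mul (measurableSet_centred_layer hS) hG').symm
    _ ≤ _ := lintegral_mono fun s => mul_le_mul_left (hF' s) _

/-- Test F against the indicator of E. The overlap of two sets is at most the smaller length, and
nested centred intervals attain it. -/
theorem LayerPair.rearrDom {F F' : ℝ → ℝ≥0∞} (h : LayerPair F F') : RearrDom F F' := by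
  intro E hE hfin
  have key : RearrDom (E.indicator 1) ((centred (volume.real E)).indicator 1) := by
    intro D hD hD'
    rw [lintegral_indicator_one hE, lintegral_indicator_one (measurableSet_centred _),
      Measure.restrict_apply hE, Measure.restrict_apply (measurableSet_centred _)]
    rcases le_total (volume.real E) (volume.real D) with hle | hle
    · have hsub : centred (volume.real E) ⊆ centred (volume.real D) :=
        Ioo_subset_Ioo (by linarith) (by linarith)
      rw [inter_eq_self_of_subset_left hsub, volume_centred, ofReal_measureReal hfin]
      exact measure_mono inter_subset_left
    · have hsub : centred (volume.real D) ⊆ centred (volume.real E) :=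
        Ioo_subset_Ioo (by linarith) (by linarith)
      rw [inter_eq_self_of_subset_right hsub, volume_centred, ofReal_measureReal hD']
      exact measure_mono inter_subset_right
  have := h.lintegral_mul_le (measurable_one.indicator hE)
    (measurable_one.indicator (measurableSet_centred _)) key
  have conv : ∀ (K : ℝ → ℝ≥0∞) {B : Set ℝ}, MeasurableSet B →
      ∫⁻ s, K s * B.indicator 1 s = ∫⁻ s in B, K s := by
    intro K B hB
    rw [← lintegral_indicator hB]
    congr 1 with s
    by_cases hs : s ∈ B <;> simp [hs]
  rwa [conv _ hE, conv _ (measurableSet_centred _)] at this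

theorem lintegral_lintegral_layer_mul {S : ℝ → Set ℝ}
    (hS : MeasurableSet {p : ℝ × ℝ | p.2 ∈ S p.1}) {g : ℝ → ℝ≥0∞} (hg : Measurable g)
    (D : Set ℝ) :
    ∫⁻ z in D, ∫⁻ s, (∫⁻ t in Ioi (0 : ℝ), (S t).indicator 1 s) * g (s - z) =
      ∫⁻ t in Ioi (0 : ℝ), ∫⁻ z in D, ∫⁻ s in S t, g (s - z) := by
  have hm := measurable_indicator_layer hS
  have h1 : ∀ z, ∫⁻ s, (∫⁻ t in Ioi (0 : ℝ), (S t).indicator 1 s) * g (s - z) =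
      ∫⁻ t in Ioi (0 : ℝ), ∫⁻ s in S t, g (s - z) := fun z =>
    lintegral_layer_mul hS (G := fun s => g (s - z)) (by fun_prop)
  simp_rw [h1]
  rw [lintegral_lintegral_swap]
  have h2 : ∀ z t, ∫⁻ s in S t, g (s - z) = ∫⁻ s, (S t).indicator 1 s * g (s - z) := by
    intro z t
    rw [← lintegral_indicator (measurableSet_slice hS t)]
    congr 1 with s
    by_cases hs : s ∈ S t <;> simp [hs]
  simp_rw [h2]
  have h3 : Measurable fun q : (ℝ × ℝ) × ℝ => (S q.1.2).indicator 1 q.2 * g (q.2 - q.1.1) :=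
    (hm.comp ((measurable_snd.comp measurable_fst).prodMk measurable_snd)).mul (by fun_prop)
  exact h3.lintegral_prod_right'.aemeasurable

/-- The inductive step of the multiple-integral inequality. Slicing F into layers reduces it to
`RearrDom.lintegral_sub` for each layer. -/
theorem RearrDom.convolution {F F' g g' : ℝ → ℝ≥0∞} (hF : LayerPair F F')
    (hF' : Measurable F') (hg : Measurable g) (hg' : Measurable g') (h : RearrDom g g')
    {c : ℝ} (hc : c ≠ 0) :
    RearrDom (fun z => ∫⁻ s, F s * g (z + c * s)) fun z => ∫⁻ s, F' s * g' (z + c * s) := by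
  have hFm := hF.measurable
  have key : ∀ {k k' : ℝ → ℝ≥0∞}, Measurable k → Measurable k' → RearrDom k k' →
      RearrDom (fun z => ∫⁻ s, F s * k (s - z)) fun z => ∫⁻ s, F' s * k' (s - z) := by
    intro k k' hk hk' hkk D hD hfin
    obtain ⟨S, hS, hSfin, hFS, hFS'⟩ := hF
    simp_rw [hFS]
    rw [lintegral_lintegral_layer_mul hS hk]
    calc ∫⁻ t in Ioi (0 : ℝ), ∫⁻ z in D, ∫⁻ s in S t, k (s - z)
        ≤ ∫⁻ t in Ioi (0 : ℝ), ∫⁻ z in centred (volume.real D),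
            ∫⁻ s in centred (volume.real (S t)), k' (s - z) :=
          setLIntegral_mono' measurableSet_Ioi fun t ht =>
            hkk.lintegral_sub hk hk' hD (measurableSet_slice hS t) hfin (hSfin t ht)
      _ = ∫⁻ z in centred (volume.real D), ∫⁻ s,
            (∫⁻ t in Ioi (0 : ℝ), (centred (volume.real (S t))).indicator 1 s) * k' (s - z) :=
          (lintegral_lintegral_layer_mul (measurableSet_centred_layer hS) hk' _).symm
      _ ≤ _ := lintegral_mono fun z => lintegral_mono fun s => mul_le_mul_left (hFS' s) _
  -- Dilating g by c and then z by -1/c turns s - z into z + c s.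
  have h1 := key (k := fun u => g (c * u)) (k' := fun u => g' (c * u)) (by fun_prop) (by fun_prop)
    (h.comp_mul_left hg hg' hc)
  have h2 := h1.comp_mul_left (c := -c⁻¹)
    (Measurable.lintegral_prod_right' (f := fun p : ℝ × ℝ => F p.2 * g (c * (p.2 - p.1)))
      (by fun_prop))
    (Measurable.lintegral_prod_right' (f := fun p : ℝ × ℝ => F' p.2 * g' (c * (p.2 - p.1)))
      (by fun_prop)) (neg_ne_zero.2 (inv_ne_zero hc))
  have e : ∀ z s : ℝ, c * (s - -c⁻¹ * z) = z + c * s := fun z s => by field_simp; ring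
  simpa only [e] using h2

theorem RearrDom.multi_convolution {m : ℕ} {F F' : Fin m → ℝ → ℝ≥0∞} {g g' : ℝ → ℝ≥0∞}
    (hF : ∀ i, LayerPair (F i) (F' i)) (hF' : ∀ i, Measurable (F' i)) (hg : Measurable g)
    (hg' : Measurable g') (h : RearrDom g g') {c : Fin m → ℝ} (hc : ∀ i, c i ≠ 0) :
    RearrDom (fun z => ∫⁻ s : Fin m → ℝ, (∏ i, F i (s i)) * g (z + ∑ i, c i * s i))
      fun z => ∫⁻ s : Fin m → ℝ, (∏ i, F' i (s i)) * g' (z + ∑ i, c i * s i) := by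
  induction m with
  | zero => simpa [lintegral_unique, volume_pi] using h
  | succ m ih =>
    have step : ∀ {K : Fin (m + 1) → ℝ → ℝ≥0∞} {k : ℝ → ℝ≥0∞}, (∀ i, Measurable (K i)) →
        Measurable k → ∀ z,
        ∫⁻ s : Fin (m + 1) → ℝ, (∏ i, K i (s i)) * k (z + ∑ i, c i * s i) =
        ∫⁻ x, K 0 x * (fun z => ∫⁻ s : Fin m → ℝ, (∏ i, K i.succ (s i)) *
          k (z + ∑ i, c i.succ * s i)) (z + c 0 * x) := by
      intro K k hK hk z
      rw [lintegral_fin_cons (by fun_prop)]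
      refine lintegral_congr fun x => ?_
      rw [← lintegral_const_mul _ (by fun_prop)]
      refine lintegral_congr fun s => ?_
      simp [Fin.prod_univ_succ, Fin.sum_univ_succ, mul_assoc, add_assoc]
    have hFm := fun i => (hF i).measurable
    have := ih (F := fun i => F i.succ) (F' := fun i => F' i.succ) (c := fun i => c i.succ)
      (fun i => hF _) (fun i => hF' _) (fun i => hc _)
    simp_rw [step hFm hg, step hF' hg']
    exact RearrDom.convolution (hF 0) (hF' 0)
      (Measurable.lintegral_prod_right' (f := fun p : ℝ × (Fin m → ℝ) =>
        (∏ i, F i.succ (p.2 i)) * g (p.1 + ∑ i, c i.succ * p.2 i)) (by fun_prop))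
      (Measurable.lintegral_prod_right' (f := fun p : ℝ × (Fin m → ℝ) =>
        (∏ i, F' i.succ (p.2 i)) * g' (p.1 + ∑ i, c i.succ * p.2 i)) (by fun_prop)) this (hc 0)

/-- The Rogers–Brascamp–Lieb–Luttinger inequality for `m + 2` functions of `m + 1` real
variables. -/
theorem lintegral_prod_mul_le {m : ℕ} {F F' : Fin (m + 1) → ℝ → ℝ≥0∞} {g g' : ℝ → ℝ≥0∞}
    (hF : ∀ i, LayerPair (F i) (F' i)) (hF' : ∀ i, Measurable (F' i)) (hg : LayerPair g g')
    (hg' : Measurable g') {c : Fin (m + 1) → ℝ} (hc : ∀ i, c i ≠ 0) :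
    ∫⁻ s : Fin (m + 1) → ℝ, (∏ i, F i (s i)) * g (∑ i, c i * s i) ≤
      ∫⁻ s : Fin (m + 1) → ℝ, (∏ i, F' i (s i)) * g' (∑ i, c i * s i) := by
  have step : ∀ {K : Fin (m + 1) → ℝ → ℝ≥0∞} {k : ℝ → ℝ≥0∞}, (∀ i, Measurable (K i)) →
      Measurable k →
      ∫⁻ s : Fin (m + 1) → ℝ, (∏ i, K i (s i)) * k (∑ i, c i * s i) =
      ∫⁻ x, K 0 x * (fun z => ∫⁻ s : Fin m → ℝ, (∏ i, K i.succ (s i)) *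
        k (z + ∑ i, c i.succ * s i)) (c 0 * x) := by
    intro K k hK hk
    rw [lintegral_fin_cons (by fun_prop)]
    refine lintegral_congr fun x => ?_
    rw [← lintegral_const_mul _ (by fun_prop)]
    refine lintegral_congr fun s => ?_
    simp [Fin.prod_univ_succ, Fin.sum_univ_succ, mul_assoc]
  have hFm := fun i => (hF i).measurable
  have hgm := hg.measurable
  have dom := RearrDom.multi_convolution (fun i : Fin m => hF i.succ) (fun i => hF' i.succ) hgm hg'
    hg.rearrDom (fun i => hc i.succ)
  have hm : Measurable fun z => ∫⁻ s : Fin m → ℝ, (∏ i, F i.succ (s i)) *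
      g (z + ∑ i, c i.succ * s i) :=
    Measurable.lintegral_prod_right' (f := fun p : ℝ × (Fin m → ℝ) =>
        (∏ i, F i.succ (p.2 i)) * g (p.1 + ∑ i, c i.succ * p.2 i)) (by fun_prop)
  have hm' : Measurable fun z => ∫⁻ s : Fin m → ℝ, (∏ i, F' i.succ (s i)) *
      g' (z + ∑ i, c i.succ * s i) :=
    Measurable.lintegral_prod_right' (f := fun p : ℝ × (Fin m → ℝ) =>
        (∏ i, F' i.succ (p.2 i)) * g' (p.1 + ∑ i, c i.succ * p.2 i)) (by fun_prop)
  rw [step hFm hgm, step hF' hg']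
  exact (hF 0).lintegral_mul_le (hm.comp (measurable_const_mul _))
    (hm'.comp (measurable_const_mul _)) (dom.comp_mul_left hm hm' (hc 0))

/-! ### Expanding a power and changing variables linearly -/

theorem lintegral_pow_eq {X : Type*} [MeasureSpace X] [SigmaFinite (volume : Measure X)]
    {f : X → ℝ≥0∞} (hf : Measurable f) (m : ℕ) :
    (∫⁻ x, f x) ^ m = ∫⁻ x : Fin m → X, ∏ i, f (x i) := by
  induction m with
  | zero => simp [lintegral_unique, volume_pi]
  | succ m ih =>
    rw [lintegral_fin_cons (by fun_prop), pow_succ', ih, ← lintegral_mul_const _ hf]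
    refine lintegral_congr fun x => ?_
    rw [← lintegral_const_mul _ (by fun_prop)]
    simp [Fin.prod_univ_succ]

/-- On each line Y + x·1 the determinant is the characteristic polynomial of -Y at x, which is monic
and so has finitely many roots. -/
theorem ae_det_ne_zero (d : ℕ) :
    ∀ᵐ Y : Fin d → Fin d → ℝ, (Matrix.of Y).det ≠ 0 := by
  let L : ℝ →ₗ[ℝ] (Fin d → Fin d → ℝ) :=
    LinearMap.toSpanSingleton ℝ (Fin d → Fin d → ℝ) (fun i j => (1 : Matrix (Fin d) (Fin d) ℝ) i j)
  have hcont : Continuous fun Y : Fin d → Fin d → ℝ => (Matrix.of Y).det :=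
    Continuous.matrix_det continuous_id
  have hs : MeasurableSet {Y : Fin d → Fin d → ℝ | (Matrix.of Y).det ≠ 0} :=
    (isOpen_ne_fun hcont continuous_const).measurableSet
  refine ae_mem_of_ae_add_linearMap_mem L volume volume hs fun Y => ?_
  have hfin : {x : ℝ | (Matrix.charpoly (-Matrix.of Y)).IsRoot x}.Finite :=
    Polynomial.finite_setOfPred_isRoot (Matrix.charpoly_monic _).ne_zero
  filter_upwards [compl_mem_ae_iff.2 (hfin.measure_zero volume)] with x hx
  intro h0
  refine hx ?_
  rw [mem_ofPred_eq, Polynomial.IsRoot, Matrix.eval_charpoly, ← h0]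
  congr 1
  ext i j
  simp [L, Matrix.scalar_apply, Matrix.diagonal_apply, Matrix.one_apply]
  ring

/-- The entries of y M⁻¹ are the coordinates of y in the basis of rows of M. The i-th one is a
linear form equal to 1 on row i, so its kernel is a null proper subspace. -/
theorem ae_vecMul_ne_zero {d : ℕ} {M : Matrix (Fin d) (Fin d) ℝ} (hM : M.det ≠ 0) :
    ∀ᵐ y : Fin d → ℝ, ∀ i, Matrix.vecMul y M⁻¹ i ≠ 0 := by
  rw [ae_all_iff]
  intro i
  let φ : (Fin d → ℝ) →ₗ[ℝ] ℝ := (LinearMap.proj i).comp (Matrix.vecMulLinear M⁻¹)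
  have hφ : LinearMap.ker φ ≠ ⊤ := by
    intro h
    have hy : Matrix.vecMul (Pi.single i 1) M ∈ LinearMap.ker φ := by rw [h]; trivial
    have hu : IsUnit M.det := isUnit_iff_ne_zero.2 hM
    rw [LinearMap.mem_ker] at hy
    change Matrix.vecMul (Matrix.vecMul (Pi.single i 1) M) M⁻¹ i = 0 at hy
    rw [Matrix.vecMul_vecMul, Matrix.mul_nonsing_inv _ hu, Matrix.vecMul_one] at hy
    simp at hy
  exact compl_mem_ae_iff.2 (Measure.addHaar_submodule volume _ hφ)

/-- Substitute s = M w. The Jacobian factor does not depend on the functions, so it is common to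
both sides of the later comparison. -/
theorem lintegral_matrix_change {d : ℕ} {M : Matrix (Fin d) (Fin d) ℝ} (hM : M.det ≠ 0)
    {F : Fin d → ℝ → ℝ≥0∞} {g : ℝ → ℝ≥0∞} (hF : ∀ i, Measurable (F i)) (hg : Measurable g)
    (y : Fin d → ℝ) :
    ∫⁻ w : Fin d → ℝ, (∏ i, F i (w ⬝ᵥ M i)) * g (w ⬝ᵥ y) =
      ENNReal.ofReal |M.det⁻¹| *
        ∫⁻ s : Fin d → ℝ, (∏ i, F i (s i)) * g (∑ i, Matrix.vecMul y M⁻¹ i * s i) := by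
  rw [← smul_eq_mul, ← lintegral_smul_measure, ← Real.map_matrix_volume_pi_eq_smul_volume_pi hM,
    lintegral_map (by fun_prop) (LinearMap.continuous_of_finiteDimensional _).measurable]
  refine lintegral_congr fun w => ?_
  have h1 : ∀ i, Matrix.toLin' M w i = w ⬝ᵥ M i := fun i => by
    rw [Matrix.toLin'_apply, dotProduct_comm]; rfl
  have h2 : ∑ i, Matrix.vecMul y M⁻¹ i * Matrix.toLin' M w i = w ⬝ᵥ y := by
    change Matrix.vecMul y M⁻¹ ⬝ᵥ Matrix.toLin' M w = _
    rw [← Matrix.dotProduct_mulVec, Matrix.toLin'_apply, Matrix.mulVec_mulVec,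
      Matrix.nonsing_inv_mul _ (isUnit_iff_ne_zero.2 hM), Matrix.one_mulVec, dotProduct_comm]
  simp_rw [h1] at h2 ⊢
  rw [h2]

/-- One of the d + 1 factors is kept apart: the other d points will serve as coordinates for w, and
this one supplies the extra linear form. -/
theorem lintegral_pow_expand {d : ℕ} {Φ : (Fin d → ℝ) → ℝ → ℝ≥0∞}
    (hΦ : Measurable (Function.uncurry Φ)) :
    ∫⁻ w : Fin d → ℝ, (∫⁻ y, Φ y (w ⬝ᵥ y)) ^ (d + 1) =
      ∫⁻ Y : Fin d → Fin d → ℝ, ∫⁻ y : Fin d → ℝ, ∫⁻ w : Fin d → ℝ,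
        (∏ i, Φ (Y i) (w ⬝ᵥ Y i)) * Φ y (w ⬝ᵥ y) := by
  have hdot : Measurable fun p : (Fin d → ℝ) × (Fin d → ℝ) => p.1 ⬝ᵥ p.2 := by
    unfold dotProduct; fun_prop
  have hdot' : ∀ {Z : Type} [MeasurableSpace Z] {a b : Z → Fin d → ℝ}, Measurable a →
      Measurable b → Measurable fun z => Φ (b z) (a z ⬝ᵥ b z) := fun ha hb =>
    hΦ.comp (hb.prodMk (hdot.comp (ha.prodMk hb)))
  have hbig : ∀ {Z : Type} [MeasurableSpace Z] {a b : Z → Fin d → ℝ}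
      {Y : Z → Fin d → Fin d → ℝ}, Measurable a → Measurable b → Measurable Y →
      Measurable fun z => (∏ i, Φ (Y z i) (a z ⬝ᵥ Y z i)) * Φ (b z) (a z ⬝ᵥ b z) :=
    fun ha hb hY => (Finset.measurable_prod _ fun i _ =>
      hdot' ha ((measurable_pi_apply i).comp hY)).mul (hdot' ha hb)
  have e : ∀ w : Fin d → ℝ, (∫⁻ y, Φ y (w ⬝ᵥ y)) ^ (d + 1) =
      ∫⁻ Y : Fin d → Fin d → ℝ, ∫⁻ y : Fin d → ℝ,
        (∏ i, Φ (Y i) (w ⬝ᵥ Y i)) * Φ y (w ⬝ᵥ y) := by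
    intro w
    have hm : Measurable fun y => Φ y (w ⬝ᵥ y) := hdot' measurable_const measurable_id
    have hm2 : Measurable fun Y : Fin d → Fin d → ℝ => ∏ i, Φ (Y i) (w ⬝ᵥ Y i) :=
      Finset.measurable_prod _ fun i _ => hm.comp (measurable_pi_apply i)
    rw [pow_succ, lintegral_pow_eq hm, ← lintegral_mul_const _ hm2]
    exact lintegral_congr fun Y => (lintegral_const_mul _ hm).symm
  simp_rw [e]
  rw [lintegral_lintegral_swap]
  · refine lintegral_congr fun Y => ?_
    rw [lintegral_lintegral_swap]
    exact (hbig measurable_fst measurable_snd measurable_const).aemeasurable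
  · exact (hbig (Z := ((Fin d → ℝ) × (Fin d → Fin d → ℝ)) × (Fin d → ℝ))
      (measurable_fst.comp measurable_fst) measurable_snd
      (measurable_snd.comp measurable_fst)).lintegral_prod_right'.aemeasurable

theorem lintegral_pow_le {m : ℕ} {Φ Φ' : (Fin (m + 1) → ℝ) → ℝ → ℝ≥0∞}
    (hΦ : Measurable (Function.uncurry Φ)) (hΦ' : Measurable (Function.uncurry Φ'))
    (h : ∀ y, LayerPair (Φ y) (Φ' y)) :
    ∫⁻ w : Fin (m + 1) → ℝ, (∫⁻ y, Φ y (w ⬝ᵥ y)) ^ (m + 2) ≤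
      ∫⁻ w : Fin (m + 1) → ℝ, (∫⁻ y, Φ' y (w ⬝ᵥ y)) ^ (m + 2) := by
  rw [lintegral_pow_expand hΦ, lintegral_pow_expand hΦ']
  refine lintegral_mono_ae ?_
  filter_upwards [ae_det_ne_zero (m + 1)] with Y hY
  refine lintegral_mono_ae ?_
  filter_upwards [ae_vecMul_ne_zero hY] with y hy
  have hs : ∀ y, Measurable (Φ y) := fun y => hΦ.comp measurable_prodMk_left
  have hs' : ∀ y, Measurable (Φ' y) := fun y => hΦ'.comp measurable_prodMk_left
  have e1 := lintegral_matrix_change hY (F := fun i => Φ (Y i)) (fun i => hs _) (hs y) y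
  have e2 := lintegral_matrix_change hY (F := fun i => Φ' (Y i)) (fun i => hs' _) (hs' y) y
  refine e1.trans_le (le_trans ?_ e2.symm.le)
  exact mul_le_mul_right (lintegral_prod_mul_le (fun i => h _) (fun i => hs' _) (h y) (hs' y) hy) _

/-! ### Orthonormal frames and hyperplanes as graphs -/

/-- `B` parametrizes the hyperplane orthogonal to the unit vector `v` isometrically. -/
structure IsFrame {d : ℕ} (v : EuclideanSpace ℝ (Fin (d + 1)))
    (B : EuclideanSpace ℝ (Fin d) →ₗᵢ[ℝ] EuclideanSpace ℝ (Fin (d + 1))) : Prop where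
  inner_eq_zero : ∀ y, ⟪v, B y⟫ = 0
  measurePreserving : MeasurePreserving
    (fun p : EuclideanSpace ℝ (Fin d) × ℝ => B p.1 + p.2 • v) volume volume
  measurableEmbedding : MeasurableEmbedding
    (fun p : EuclideanSpace ℝ (Fin d) × ℝ => B p.1 + p.2 • v)
  surjective : Function.Surjective
    (fun p : EuclideanSpace ℝ (Fin d) × ℝ => B p.1 + p.2 • v)

/-- The isometric embedding that prepends a zero coordinate. -/
def consZero (d : ℕ) : EuclideanSpace ℝ (Fin d) →ₗᵢ[ℝ] EuclideanSpace ℝ (Fin (d + 1)) where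
  toFun y := WithLp.toLp 2 (Fin.cons 0 y.ofLp : Fin (d + 1) → ℝ)
  map_add' x y := by
    ext i; refine Fin.cases ?_ (fun j => ?_) i <;> simp
  map_smul' c y := by
    ext i; refine Fin.cases ?_ (fun j => ?_) i <;> simp
  norm_map' y := by
    simp [EuclideanSpace.norm_eq, Fin.sum_univ_succ]

/-- Complete v to an orthonormal basis with v in position 0; the remaining coordinates parametrize
v^⊥. -/
theorem exists_isFrame {d : ℕ} {v : EuclideanSpace ℝ (Fin (d + 1))} (hv : ‖v‖ = 1) :
    ∃ B : EuclideanSpace ℝ (Fin d) →ₗᵢ[ℝ] EuclideanSpace ℝ (Fin (d + 1)), IsFrame v B := by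
  obtain ⟨b, hb⟩ := Orthonormal.exists_orthonormalBasis_extension_of_card_eq (𝕜 := ℝ)
    (E := EuclideanSpace ℝ (Fin (d + 1))) (ι := Fin (d + 1)) (by simp) (v := fun _ => v) (s := {0})
    ⟨fun i => hv, fun i j hij => absurd (Subsingleton.elim i j) hij⟩
  have hb0 : b 0 = v := hb 0 rfl
  let B : EuclideanSpace ℝ (Fin d) →ₗᵢ[ℝ] EuclideanSpace ℝ (Fin (d + 1)) :=
    b.repr.symm.toLinearIsometry.comp (consZero d)
  let e : EuclideanSpace ℝ (Fin d) × ℝ ≃ᵐ EuclideanSpace ℝ (Fin (d + 1)) :=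
    ((((MeasurableEquiv.toLp 2 (Fin d → ℝ)).symm.prodCongr (MeasurableEquiv.refl ℝ)).trans
      MeasurableEquiv.prodComm).trans
      (MeasurableEquiv.piFinSuccAbove (fun _ : Fin (d + 1) => ℝ) 0).symm).trans
      ((MeasurableEquiv.toLp 2 (Fin (d + 1) → ℝ)).trans b.measurableEquiv.symm)
  have he : (fun p : EuclideanSpace ℝ (Fin d) × ℝ => B p.1 + p.2 • v) = e := by
    ext1 p
    have h1 : e p = b.repr.symm (WithLp.toLp 2 (Fin.cons p.2 p.1.ofLp : Fin (d + 1) → ℝ)) := by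
      simp [e, MeasurableEquiv.piFinSuccAbove, Fin.insertNthEquiv]
      rfl
    have h2 : p.2 • v = b.repr.symm (p.2 • EuclideanSpace.single 0 1) := by
      rw [map_smul, b.repr_symm_single, hb0]
    have h3 : B p.1 = b.repr.symm (WithLp.toLp 2 (Fin.cons 0 p.1.ofLp : Fin (d + 1) → ℝ)) := rfl
    rw [h1, h2, h3, ← map_add]
    congr 1
    ext i
    refine Fin.cases ?_ (fun j => ?_) i <;> simp
  have hmp : MeasurePreserving e volume volume := by
    have p1 : MeasurePreserving
        ((MeasurableEquiv.toLp 2 (Fin d → ℝ)).symm.prodCongr (MeasurableEquiv.refl ℝ)) :=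
      (EuclideanSpace.volume_preserving_symm_measurableEquiv_toLp (Fin d)).prod
        (MeasurePreserving.id volume)
    have p2 : MeasurePreserving (MeasurableEquiv.prodComm (α := Fin d → ℝ) (β := ℝ)) :=
      Measure.measurePreserving_swap
    have p3 := (volume_preserving_piFinSuccAbove (fun _ : Fin (d + 1) => ℝ) 0).symm
    have p4 := (EuclideanSpace.volume_preserving_symm_measurableEquiv_toLp (Fin (d + 1))).symm
    have p5 := b.measurePreserving_measurableEquiv.symm
    exact ((p1.trans p2).trans p3).trans (p4.trans p5)
  refine ⟨B, ?_, ?_, ?_, ?_⟩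
  · intro y
    rw [← hb0]
    have : B y = b.repr.symm (WithLp.toLp 2 (Fin.cons 0 y.ofLp : Fin (d + 1) → ℝ)) := rfl
    rw [this, ← b.repr_apply_apply]
    simp
  · rw [he]; exact hmp
  · rw [he]; exact e.measurableEmbedding
  · rw [he]; exact e.surjective

section

variable {d : ℕ} {v u : EuclideanSpace ℝ (Fin (d + 1))}
  {B : EuclideanSpace ℝ (Fin d) →ₗᵢ[ℝ] EuclideanSpace ℝ (Fin (d + 1))}

theorem IsFrame.inner_add_smul (hB : IsFrame v B) (hv : ‖v‖ = 1) (y : EuclideanSpace ℝ (Fin d))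
    (s : ℝ) : ⟪v, B y + s • v⟫ = s := by
  rw [inner_add_right, hB.inner_eq_zero, inner_smul_right, real_inner_self_eq_norm_sq, hv]
  norm_num

theorem IsFrame.range_eq (hB : IsFrame v B) (hv : ‖v‖ = 1) : range B = hyperplane v := by
  ext x
  constructor
  · rintro ⟨y, rfl⟩
    exact hB.inner_eq_zero y
  · intro hx
    obtain ⟨⟨y, s⟩, rfl⟩ := hB.surjective x
    have h1 := hB.inner_add_smul hv y s
    have h2 : ⟪v, B y + s • v⟫ = 0 := hx
    have h3 : s = 0 := h1.symm.trans h2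
    exact ⟨y, by simp [h3]⟩

theorem IsFrame.setLIntegral_hyperplane (hB : IsFrame v B) (hv : ‖v‖ = 1)
    {g : EuclideanSpace ℝ (Fin (d + 1)) → ℝ≥0∞} (hg : Measurable g) :
    ∫⁻ y in hyperplane v, g y ∂μHE[d] = ∫⁻ y, g (B y) := by
  rw [← hB.range_eq hv, ← B.isometry.map_euclideanHausdorffMeasure,
    EuclideanSpace.euclideanHausdorffMeasure_eq_volume, lintegral_map hg B.continuous.measurable]

theorem IsFrame.lintegral_eq (hB : IsFrame v B)
    {F : EuclideanSpace ℝ (Fin (d + 1)) → ℝ≥0∞} (hF : Measurable F) :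
    ∫⁻ x, F x = ∫⁻ s : ℝ, ∫⁻ y, F (B y + s • v) := by
  have hc : Measurable fun p : EuclideanSpace ℝ (Fin d) × ℝ => F (B p.1 + p.2 • v) :=
    hF.comp hB.measurePreserving.measurable
  rw [← hB.measurePreserving.lintegral_comp hF, Measure.volume_eq_prod,
    lintegral_prod_symm _ hc.aemeasurable]

/-- The unit normal of the hyperplane `{B y + ⟪w, y⟫ u}`. -/
def graphNormal (u : EuclideanSpace ℝ (Fin (d + 1)))
    (B : EuclideanSpace ℝ (Fin d) →ₗᵢ[ℝ] EuclideanSpace ℝ (Fin (d + 1)))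
    (w : EuclideanSpace ℝ (Fin d)) : EuclideanSpace ℝ (Fin (d + 1)) :=
  (√(1 + ‖w‖ ^ 2))⁻¹ • (u - B w)

theorem IsFrame.norm_graphNormal (hB : IsFrame u B) (hu : ‖u‖ = 1) (w : EuclideanSpace ℝ (Fin d)) :
    ‖graphNormal u B w‖ = 1 := by
  have h1 : ‖u - B w‖ ^ 2 = 1 + ‖w‖ ^ 2 := by
    rw [norm_sub_sq_real, hB.inner_eq_zero, hu, B.norm_map]; ring
  have h2 : ‖u - B w‖ = √(1 + ‖w‖ ^ 2) := by
    rw [← h1, Real.sqrt_sq (norm_nonneg _)]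
  have h3 : 0 < √(1 + ‖w‖ ^ 2) := Real.sqrt_pos.2 (by positivity)
  rw [graphNormal, norm_smul, h2, norm_inv, Real.norm_of_nonneg h3.le, inv_mul_cancel₀ h3.ne']

theorem IsFrame.inner_graphNormal (hB : IsFrame u B) (hu : ‖u‖ = 1)
    (w y : EuclideanSpace ℝ (Fin d)) (s : ℝ) :
    ⟪graphNormal u B w, B y + s • u⟫ = (√(1 + ‖w‖ ^ 2))⁻¹ * (s - ⟪w, y⟫) := by
  have h : ⟪B w, u⟫ = 0 := by rw [real_inner_comm]; exact hB.inner_eq_zero w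
  rw [graphNormal, real_inner_smul_left, inner_sub_left, hB.inner_add_smul hu, inner_add_right,
    B.inner_map_map, inner_smul_right, h]
  ring

theorem lintegral_affine {σ : ℝ} (hσ : 0 < σ) (c : ℝ) {φ : ℝ → ℝ≥0∞} (hφ : Measurable φ) :
    ∫⁻ s, φ s = ENNReal.ofReal σ * ∫⁻ τ, φ (σ * τ + c) := by
  have h := lintegral_comp_mul_left hσ.ne' (G := fun x => φ (x + c)) (by fun_prop)
    MeasurableSet.univ
  simp only [Measure.restrict_univ, preimage_univ] at h
  rw [h, lintegral_add_right_eq_self φ c, ← mul_assoc, ← ENNReal.ofReal_mul hσ.le,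
    abs_of_pos (inv_pos.2 hσ), mul_inv_cancel₀ hσ.ne', ENNReal.ofReal_one, one_mul]

/-- The integral over a hyperplane, written as a graph over `u^⊥`. -/
theorem IsFrame.setLIntegral_graphNormal (hB : IsFrame u B) (hu : ‖u‖ = 1)
    {g : EuclideanSpace ℝ (Fin (d + 1)) → ℝ≥0∞} (hg : Measurable g)
    (w : EuclideanSpace ℝ (Fin d)) :
    ∫⁻ y in hyperplane (graphNormal u B w), g y ∂μHE[d] =
      ENNReal.ofReal √(1 + ‖w‖ ^ 2) * ∫⁻ y, g (B y + ⟪w, y⟫ • u) := by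
  have hθ := hB.norm_graphNormal hu w
  have hin := hB.inner_graphNormal hu w
  have hθdef : graphNormal u B w = (√(1 + ‖w‖ ^ 2))⁻¹ • (u - B w) := rfl
  have hσ : 0 < √(1 + ‖w‖ ^ 2) := Real.sqrt_pos.2 (by positivity)
  have hσ2 : √(1 + ‖w‖ ^ 2) ^ 2 = 1 + ‖w‖ ^ 2 := Real.sq_sqrt (by positivity)
  set σ := √(1 + ‖w‖ ^ 2)
  set θ := graphNormal u B w
  obtain ⟨C, hC⟩ := exists_isFrame hθ
  have hBm : Measurable B := B.continuous.measurable
  have hind : Measurable ((Icc (0 : ℝ) 1).indicator (1 : ℝ → ℝ≥0∞)) :=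
    measurable_one.indicator measurableSet_Icc
  -- Extend g from the hyperplane to a slab of thickness 1, constantly along θ. Fubini along θ gives
  -- the hyperplane integral, and Fubini along u gives the graph integral.
  set F : EuclideanSpace ℝ (Fin (d + 1)) → ℝ≥0∞ := fun x =>
    (Icc (0 : ℝ) 1).indicator 1 ⟪θ, x⟫ * g (x - ⟪θ, x⟫ • θ) with hF
  have hin' : Measurable fun x : EuclideanSpace ℝ (Fin (d + 1)) => ⟪θ, x⟫ := by fun_prop
  have hFm : Measurable F := (hind.comp hin').mul
    (hg.comp (measurable_id.sub (hin'.smul_const θ)))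
  have e1 : ∫⁻ x, F x = ∫⁻ y in hyperplane θ, g y ∂μHE[d] := by
    rw [hC.lintegral_eq hFm, hC.setLIntegral_hyperplane hθ hg]
    have : ∀ s : ℝ, ∫⁻ y, F (C y + s • θ) =
        (Icc (0 : ℝ) 1).indicator 1 s * ∫⁻ y, g (C y) := by
      intro s
      rw [← lintegral_const_mul _ (f := fun y => g (C y)) (hg.comp C.continuous.measurable)]
      simp only [hF, hC.inner_add_smul hθ, add_sub_cancel_right]
    simp_rw [this]
    rw [lintegral_mul_const _ hind, lintegral_indicator_one measurableSet_Icc]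
    simp
  have e2 : ∫⁻ x, F x = ENNReal.ofReal σ * ∫⁻ y, g (B y + ⟪w, y⟫ • u) := by
    rw [hB.lintegral_eq hFm, lintegral_lintegral_swap
      (f := fun (s : ℝ) y => F (B y + s • u)) (hFm.comp (by fun_prop : Measurable fun p : ℝ × EuclideanSpace ℝ (Fin d) =>
        B p.2 + p.1 • u)).aemeasurable]
    -- With s = σ τ + ⟪w, y⟫ the height over the hyperplane is τ, and the foot of the perpendicular
    -- is the graph point over y + (τ/σ) w. Translation invariance in y then removes the shift.
    have hτ : ∀ (τ : ℝ) y, F (B y + (σ * τ + ⟪w, y⟫) • u) = (Icc (0 : ℝ) 1).indicator 1 τ *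
        g (B (y + (τ * σ⁻¹) • w) + ⟪w, y + (τ * σ⁻¹) • w⟫ • u) := by
      intro τ y
      have h1 : ⟪θ, B y + (σ * τ + ⟪w, y⟫) • u⟫ = τ := by
        rw [hin, add_sub_cancel_right, inv_mul_cancel_left₀ hσ.ne']
      simp only [hF, h1]
      congr 2
      rw [hθdef, map_add, map_smul, inner_add_right, inner_smul_right, real_inner_self_eq_norm_sq]
      have h2 : σ * τ + ⟪w, y⟫ = τ * σ⁻¹ + (⟪w, y⟫ + τ * σ⁻¹ * ‖w‖ ^ 2) := by
        field_simp
        linear_combination τ * hσ2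
      rw [h2]
      module
    have h3 : ∀ y, ∫⁻ s : ℝ, F (B y + s • u) = ENNReal.ofReal σ * ∫⁻ τ : ℝ,
        (Icc (0 : ℝ) 1).indicator 1 τ *
          g (B (y + (τ * σ⁻¹) • w) + ⟪w, y + (τ * σ⁻¹) • w⟫ • u) := by
      intro y
      rw [lintegral_affine hσ ⟪w, y⟫ (φ := fun s => F (B y + s • u))
        (hFm.comp (by fun_prop : Measurable fun s : ℝ => B y + s • u))]
      simp_rw [hτ]
    have hG : Measurable fun y => g (B y + ⟪w, y⟫ • u) := by fun_prop
    have hG2 : Measurable fun p : EuclideanSpace ℝ (Fin d) × ℝ =>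
        (Icc (0 : ℝ) 1).indicator 1 p.2 *
          g (B (p.1 + (p.2 * σ⁻¹) • w) + ⟪w, p.1 + (p.2 * σ⁻¹) • w⟫ • u) :=
      (hind.comp measurable_snd).mul (by fun_prop)
    simp_rw [h3]
    rw [lintegral_const_mul _ hG2.lintegral_prod_right',
      lintegral_lintegral_swap hG2.aemeasurable]
    congr 1
    have h4 : ∀ τ : ℝ, ∫⁻ y, (Icc (0 : ℝ) 1).indicator 1 τ *
          g (B (y + (τ * σ⁻¹) • w) + ⟪w, y + (τ * σ⁻¹) • w⟫ • u) =
        (Icc (0 : ℝ) 1).indicator 1 τ * ∫⁻ y, g (B y + ⟪w, y⟫ • u) := by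
      intro τ
      rw [lintegral_const_mul _ (by fun_prop),
        lintegral_add_right_eq_self (fun y => g (B y + ⟪w, y⟫ • u))]
    simp_rw [h4]
    rw [lintegral_mul_const _ hind, lintegral_indicator_one measurableSet_Icc]
    simp
  rw [← e1, e2]

end

/-! ### The volume of an intersection body as an integral over graphs -/

section

theorem smul_mem_starShaped {n : ℕ} {ρ : EuclideanSpace ℝ (Fin n) → ℝ}
    {θ : EuclideanSpace ℝ (Fin n)} (hθ : ‖θ‖ = 1) {r : ℝ} (hr : 0 < r) :
    r • θ ∈ starShaped ρ ↔ r ≤ ρ θ := by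
  constructor
  · rintro ⟨θ', hθ', r', hr', h⟩
    have h1 : r = r' := by
      have := congrArg norm h
      rwa [norm_smul, norm_smul, hθ, hθ', mul_one, mul_one, Real.norm_of_nonneg hr.le,
        Real.norm_of_nonneg hr'.1] at this
    subst h1
    rw [smul_right_injective _ hr.ne' h]
    exact hr'.2
  · intro h
    exact ⟨θ, hθ, r, ⟨hr.le, h⟩, rfl⟩

theorem hyperplane_neg {n : ℕ} (θ : EuclideanSpace ℝ (Fin n)) :
    hyperplane (-θ) = hyperplane θ := by
  ext y; simp [hyperplane]

theorem neg_mem_intersectionBodyFun {n : ℕ} {g : EuclideanSpace ℝ (Fin n) → ℝ}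
    {x : EuclideanSpace ℝ (Fin n)} :
    -x ∈ intersectionBodyFun g ↔ x ∈ intersectionBodyFun g := by
  have key : ∀ x, x ∈ intersectionBodyFun g → -x ∈ intersectionBodyFun g := by
    rintro x ⟨θ, hθ, r, hr, rfl⟩
    refine ⟨-θ, by rwa [norm_neg], r, ?_, by rw [smul_neg]⟩
    simpa only [hyperplane_neg] using hr
  exact ⟨fun h => by simpa using key _ h, key x⟩

theorem lintegral_abs_pow_Icc (d : ℕ) {j : ℝ} (hj : 0 ≤ j) :
    ∫⁻ s in Icc (-j) j, ENNReal.ofReal (|s| ^ d) =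
      ENNReal.ofReal j ^ (d + 1) * ∫⁻ s in Icc (-1 : ℝ) 1, ENNReal.ofReal (|s| ^ d) := by
  rcases hj.eq_or_lt with rfl | hj
  · simp
  have h := lintegral_comp_mul_left hj.ne' (G := fun s => ENNReal.ofReal (|s| ^ d)) (by fun_prop)
    (measurableSet_Icc (a := (-1 : ℝ)) (b := 1))
  have e : (fun x => j⁻¹ * x) ⁻¹' Icc (-1 : ℝ) 1 = Icc (-j) j := by
    ext x
    rw [mem_preimage, mem_Icc, mem_Icc, ← abs_le, ← abs_le, abs_mul, abs_inv, abs_of_pos hj,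
      inv_mul_le_iff₀ hj, mul_one]
  have h2 : ∀ s : ℝ, ENNReal.ofReal (|j * s| ^ d) =
      ENNReal.ofReal j ^ d * ENNReal.ofReal (|s| ^ d) := by
    intro s
    rw [abs_mul, mul_pow, ENNReal.ofReal_mul (by positivity), abs_of_pos hj,
      ENNReal.ofReal_pow hj.le]
  simp_rw [h2] at h
  rw [e, lintegral_const_mul _ (by fun_prop), abs_of_pos (inv_pos.2 hj)] at h
  rw [pow_succ', mul_assoc, h, ← mul_assoc, ← ENNReal.ofReal_mul hj.le, mul_inv_cancel₀ hj.ne',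
    ENNReal.ofReal_one, one_mul]

variable {d : ℕ} {u : EuclideanSpace ℝ (Fin (d + 1))}
  {B : EuclideanSpace ℝ (Fin d) →ₗᵢ[ℝ] EuclideanSpace ℝ (Fin (d + 1))}

/-- The integral of `g` over the graph `{B y + ⟪w, y⟫ u}` with respect to the base measure. -/
def graphIntegral (u : EuclideanSpace ℝ (Fin (d + 1)))
    (B : EuclideanSpace ℝ (Fin d) →ₗᵢ[ℝ] EuclideanSpace ℝ (Fin (d + 1)))
    (g : EuclideanSpace ℝ (Fin (d + 1)) → ℝ) (w : EuclideanSpace ℝ (Fin d)) : ℝ≥0∞ :=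
  ∫⁻ y, ENNReal.ofReal (g (B y + ⟪w, y⟫ • u))

theorem measurable_graphIntegral {g : EuclideanSpace ℝ (Fin (d + 1)) → ℝ} (hg : Measurable g) :
    Measurable (graphIntegral u B g) := by
  have hBm : Measurable B := B.continuous.measurable
  have : Measurable fun p : EuclideanSpace ℝ (Fin d) × EuclideanSpace ℝ (Fin d) =>
      ENNReal.ofReal (g (B p.2 + ⟪p.1, p.2⟫ • u)) := by fun_prop
  exact this.lintegral_prod_right'

/-- For s > 0 and w = -z/s the point is s √(1 + ‖w‖²) times the unit normal of the graph of w; this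
square root cancels against the one in the hyperplane integral. Negative s follows by central
symmetry. -/
theorem IsFrame.mem_intersectionBodyFun (hB : IsFrame u B) (hu : ‖u‖ = 1)
    {g : EuclideanSpace ℝ (Fin (d + 1)) → ℝ} (hg : Measurable g) (h0 : ∀ x, 0 ≤ g x)
    (z : EuclideanSpace ℝ (Fin d)) {s : ℝ} (hs : s ≠ 0) :
    B z + s • u ∈ intersectionBodyFun g ↔ |s| ≤ (graphIntegral u B g (-s⁻¹ • z)).toReal := by
  have pos : ∀ (z : EuclideanSpace ℝ (Fin d)) {s : ℝ}, 0 < s →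
      (B z + s • u ∈ intersectionBodyFun g ↔ s ≤ (graphIntegral u B g (-s⁻¹ • z)).toReal) := by
    intro z s hs
    set w := -s⁻¹ • z with hw
    have hσ : 0 < √(1 + ‖w‖ ^ 2) := Real.sqrt_pos.2 (by positivity)
    have e : B z + s • u = (s * √(1 + ‖w‖ ^ 2)) • graphNormal u B w := by
      rw [graphNormal, smul_smul, mul_assoc, mul_inv_cancel₀ hσ.ne', mul_one, smul_sub, ← map_smul,
        hw, smul_smul, mul_neg, mul_inv_cancel₀ hs.ne', neg_smul, one_smul, map_neg]
      abel
    rw [e, intersectionBodyFun, smul_mem_starShaped (hB.norm_graphNormal hu w) (by positivity)]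
    have hint : ∫ y in hyperplane (graphNormal u B w), g y ∂μHE[d + 1 - 1] =
        √(1 + ‖w‖ ^ 2) * (graphIntegral u B g w).toReal := by
      rw [integral_eq_lintegral_of_nonneg_ae (Filter.Eventually.of_forall h0)
        hg.aestronglyMeasurable, Nat.add_sub_cancel,
        hB.setLIntegral_graphNormal hu hg.ennreal_ofReal, ENNReal.toReal_mul,
        ENNReal.toReal_ofReal hσ.le, graphIntegral]
    rw [hint, mul_comm s, mul_le_mul_iff_right₀ hσ]
  rcases lt_or_gt_of_ne hs with hneg | hpos
  · rw [← neg_mem_intersectionBodyFun]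
    have : -(B z + s • u) = B (-z) + (-s) • u := by rw [map_neg, neg_smul]; abel
    rw [this, pos (-z) (neg_pos.2 hneg), abs_of_neg hneg]
    simp
  · rw [pos z hpos, abs_of_pos hpos]

/-- The volume of the intersection body of `g` as an integral over graphs. -/
theorem IsFrame.volume_intersectionBodyFun (hB : IsFrame u B) (hu : ‖u‖ = 1)
    {g : EuclideanSpace ℝ (Fin (d + 1)) → ℝ} (hg : Measurable g) (h0 : ∀ x, 0 ≤ g x)
    (hfin : ∀ w, graphIntegral u B g w ≠ ∞) :
    volume (intersectionBodyFun g) = (∫⁻ s in Icc (-1 : ℝ) 1, ENNReal.ofReal (|s| ^ d)) *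
      ∫⁻ w, graphIntegral u B g w ^ (d + 1) := by
  set J : EuclideanSpace ℝ (Fin d) → ℝ := fun w => (graphIntegral u B g w).toReal with hJ
  have hJm : Measurable J := (measurable_graphIntegral hg).ennreal_toReal
  set T : Set (EuclideanSpace ℝ (Fin d) × ℝ) := {p | |p.2| ≤ J (-p.2⁻¹ • p.1)} with hT
  have hTm : MeasurableSet T := measurableSet_le (by fun_prop) (hJm.comp (by fun_prop))
  have hline : (volume : Measure (EuclideanSpace ℝ (Fin d) × ℝ)) {p | p.2 = 0} = 0 := by
    have : {p : EuclideanSpace ℝ (Fin d) × ℝ | p.2 = 0} = univ ×ˢ {0} := by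
      ext p; simp
    rw [this, Measure.volume_eq_prod, Measure.prod_prod]
    simp
  have hvol : volume (intersectionBodyFun g) = volume T := by
    rw [← hB.measurePreserving.measure_preimage_emb hB.measurableEmbedding]
    refine measure_congr ?_
    filter_upwards [compl_mem_ae_iff.2 hline] with p hp
    exact propext (hB.mem_intersectionBodyFun hu hg h0 p.1 hp)
  -- At fixed height s the substitution z = -s w has Jacobian |s|^d. Integrating |s|^d over |s| ≤
  -- J(w) then yields the power d + 1.
  have hslice : ∀ s : ℝ, s ≠ 0 → volume ((fun z => (z, s)) ⁻¹' T) =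
      ENNReal.ofReal (|s| ^ d) * volume {w | |s| ≤ J w} := by
    intro s hs
    have e : (fun z => (z, s)) ⁻¹' T = ((-s⁻¹) • ·) ⁻¹' {w | |s| ≤ J w} := rfl
    rw [e, Measure.addHaar_preimage_smul volume (neg_ne_zero.2 (inv_ne_zero hs))]
    congr 2
    simp [abs_inv, abs_pow]
  have hm2 : Measurable fun p : EuclideanSpace ℝ (Fin d) × ℝ =>
      (Icc (-J p.1) (J p.1)).indicator (fun s => ENNReal.ofReal (|s| ^ d)) p.2 := by
    have : MeasurableSet {p : EuclideanSpace ℝ (Fin d) × ℝ | p.2 ∈ Icc (-J p.1) (J p.1)} :=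
      (measurableSet_le (hJm.comp measurable_fst).neg measurable_snd).inter
        (measurableSet_le measurable_snd (hJm.comp measurable_fst))
    exact (by fun_prop : Measurable fun p : EuclideanSpace ℝ (Fin d) × ℝ =>
      ENNReal.ofReal (|p.2| ^ d)).indicator this
  calc volume (intersectionBodyFun g) = volume T := hvol
    _ = ∫⁻ s : ℝ, volume ((fun z => (z, s)) ⁻¹' T) := by
      rw [Measure.volume_eq_prod, Measure.prod_apply_symm hTm]
    _ = ∫⁻ s : ℝ, ENNReal.ofReal (|s| ^ d) * volume {w | |s| ≤ J w} := by
      refine lintegral_congr_ae ?_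
      filter_upwards [compl_mem_ae_iff.2 (measure_singleton (0 : ℝ))] with s hs
      exact hslice s hs
    _ = ∫⁻ s : ℝ, ∫⁻ w, (Icc (-J w) (J w)).indicator
          (fun s => ENNReal.ofReal (|s| ^ d)) s := by
      refine lintegral_congr fun s => ?_
      have hset : MeasurableSet {w | |s| ≤ J w} := measurableSet_le measurable_const hJm
      rw [← lintegral_indicator_one hset, ← lintegral_const_mul _ (measurable_one.indicator hset)]
      refine lintegral_congr fun w => ?_
      by_cases h : |s| ≤ J w
      · rw [indicator_of_mem (show s ∈ Icc _ _ from abs_le.1 h),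
          indicator_of_mem (show w ∈ {w | |s| ≤ J w} from h)]
        simp
      · rw [indicator_of_notMem (show s ∉ Icc _ _ from fun hh => h (abs_le.2 hh)),
          indicator_of_notMem (show w ∉ {w | |s| ≤ J w} from h), mul_zero]
    _ = ∫⁻ w, ∫⁻ s : ℝ, (Icc (-J w) (J w)).indicator
          (fun s => ENNReal.ofReal (|s| ^ d)) s :=
      (lintegral_lintegral_swap hm2.aemeasurable).symm
    _ = ∫⁻ w, (∫⁻ s in Icc (-1 : ℝ) 1, ENNReal.ofReal (|s| ^ d)) *
          graphIntegral u B g w ^ (d + 1) := by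
      refine lintegral_congr fun w => ?_
      rw [lintegral_indicator measurableSet_Icc, lintegral_abs_pow_Icc d ENNReal.toReal_nonneg,
        ENNReal.ofReal_toReal (hfin w), mul_comm]
    _ = _ := lintegral_const_mul _ ((measurable_graphIntegral hg).pow_const _)

end

/-! ### Measurability and bounds for Steiner symmetrization -/

section Steiner

variable {n : ℕ} {u : EuclideanSpace ℝ (Fin n)}

theorem mem_steiner_iff (hu : ‖u‖ = 1) {K : Set (EuclideanSpace ℝ (Fin n))}
    {x : EuclideanSpace ℝ (Fin n)} :
    x ∈ steiner u K ↔ (fiber u K (x - ⟪u, x⟫ • u)).Nonempty ∧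
      |⟪u, x⟫| ≤ volume.real (fiber u K (x - ⟪u, x⟫ • u)) / 2 := by
  have huu : ⟪u, u⟫ = 1 := by rw [real_inner_self_eq_norm_sq, hu]; norm_num
  constructor
  · rintro ⟨y, hy, hne, s, hs, rfl⟩
    have hy' : ⟪u, y⟫ = 0 := hy
    have h1 : ⟪u, y + s • u⟫ = s := by rw [inner_add_right, hy', inner_smul_right, huu]; ring
    rw [h1, add_sub_cancel_right]
    exact ⟨hne, hs⟩
  · rintro ⟨hne, hs⟩
    refine ⟨x - ⟪u, x⟫ • u, ?_, hne, ⟪u, x⟫, hs, by abel⟩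
    change ⟪u, x - ⟪u, x⟫ • u⟫ = 0
    rw [inner_sub_right, inner_smul_right, huu, mul_one, sub_self]

/-- The heights `t` for which `x` lies in the symmetral of the superlevel set `{f ≥ t}`. -/
def steinerLevels (u : EuclideanSpace ℝ (Fin n)) (f : EuclideanSpace ℝ (Fin n) → ℝ)
    (x : EuclideanSpace ℝ (Fin n)) : Set ℝ :=
  {t | 0 < t ∧ x ∈ steiner u {z | t ≤ f z}}

/-- A nonnegative upper semicontinuous function bounded by `M` that vanishes outside the ball of
radius `R`. -/
structure IsAdmissible (f : EuclideanSpace ℝ (Fin n) → ℝ) (M R : ℝ) : Prop where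
  nonneg : ∀ x, 0 ≤ f x
  usc : UpperSemicontinuous f
  le : ∀ x, f x ≤ M
  norm_le : ∀ x, 0 < f x → ‖x‖ ≤ R

variable {f : EuclideanSpace ℝ (Fin n) → ℝ} {M R : ℝ}

theorem exists_isAdmissible (h0 : ∀ x, 0 ≤ f x) (hf : UpperSemicontinuous f)
    (hc : HasCompactSupport f) : ∃ M R, IsAdmissible f M R := by
  obtain ⟨M, hM⟩ := (hf.upperSemicontinuousOn (tsupport f)).bddAbove_of_isCompact hc
  obtain ⟨R, hR⟩ := hc.isBounded.exists_norm_le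
  refine ⟨max M 0, R, h0, hf, fun x => ?_, fun x hx => hR x (subset_tsupport f hx.ne')⟩
  by_cases hx : x ∈ tsupport f
  · exact (hM ⟨x, hx, rfl⟩).trans (le_max_left _ _)
  · rw [image_eq_zero_of_notMem_tsupport hx]
    exact le_max_right _ _

/-- Projections of Borel sets need not be Borel. Here the part of the hypograph with t ≥ 1/(k+1) is
closed by upper semicontinuity and bounded, so its projection is compact, and countably many k
suffice. -/
theorem IsAdmissible.measurableSet_nonempty_fiber (h : IsAdmissible f M R) (hu : ‖u‖ = 1) :
    MeasurableSet {q : EuclideanSpace ℝ (Fin n) × ℝ |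
      0 < q.2 ∧ (fiber u {z | q.2 ≤ f z} (q.1 - ⟪u, q.1⟫ • u)).Nonempty} := by
  have huu : ⟪u, u⟫ = 1 := by rw [real_inner_self_eq_norm_sq, hu]; norm_num
  set P : EuclideanSpace ℝ (Fin n) × ℝ → EuclideanSpace ℝ (Fin n) × ℝ :=
    fun q => (q.1 - ⟪u, q.1⟫ • u, q.2) with hP
  have hPc : Continuous P := by fun_prop
  set Z : ℕ → Set (EuclideanSpace ℝ (Fin n) × ℝ) :=
    fun k => {q | q.2 ≤ f q.1} ∩ {q | 1 / ((k : ℝ) + 1) ≤ q.2} with hZ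
  have hZc : ∀ k, IsCompact (Z k) := by
    intro k
    refine IsCompact.of_isClosed_subset ((isCompact_closedBall 0 R).prod
      (isCompact_Icc (a := (0 : ℝ)) (b := M))) ?_ ?_
    · exact h.usc.IsClosed_hypograph.inter (isClosed_le continuous_const continuous_snd)
    · rintro ⟨x, t⟩ ⟨h1, h2⟩
      have h1' : t ≤ f x := h1
      have h2' : 1 / ((k : ℝ) + 1) ≤ t := h2
      have ht : 0 < t := lt_of_lt_of_le (by positivity) h2'
      refine ⟨?_, ht.le, h1'.trans (h.le x)⟩
      rw [mem_closedBall_zero_iff]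
      exact h.norm_le x (ht.trans_le h1')
  have e : {q : EuclideanSpace ℝ (Fin n) × ℝ |
      0 < q.2 ∧ (fiber u {z | q.2 ≤ f z} (q.1 - ⟪u, q.1⟫ • u)).Nonempty} =
      ⋃ k, P ⁻¹' (P '' Z k) := by
    ext ⟨x, t⟩
    simp only [mem_iUnion]
    constructor
    · rintro ⟨ht, s, hs⟩
      obtain ⟨k, hk⟩ := exists_nat_one_div_lt ht
      refine ⟨k, (x - ⟪u, x⟫ • u + s • u, t), ⟨hs, hk.le⟩, ?_⟩
      have : ⟪u, x - ⟪u, x⟫ • u + s • u⟫ = s := by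
        rw [inner_add_right, inner_sub_right, inner_smul_right, inner_smul_right, huu]; ring
      simp only [hP, this, add_sub_cancel_right]
    · rintro ⟨k, ⟨z, t'⟩, ⟨h1, h2⟩, h3⟩
      simp only [hP, Prod.mk.injEq] at h3
      obtain ⟨h3, rfl⟩ := h3
      have h2' : 1 / ((k : ℝ) + 1) ≤ t' := h2
      refine ⟨lt_of_lt_of_le (by positivity) h2', ⟪u, z⟫, ?_⟩
      change t' ≤ f (x - ⟪u, x⟫ • u + ⟪u, z⟫ • u)
      rw [← h3, sub_add_cancel]
      exact h1
  rw [e]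
  exact MeasurableSet.iUnion fun k =>
    (((hZc k).image hPc).isClosed.preimage hPc).measurableSet

theorem IsAdmissible.measurableSet_steinerLevels (h : IsAdmissible f M R) (hu : ‖u‖ = 1) :
    MeasurableSet {q : EuclideanSpace ℝ (Fin n) × ℝ | q.2 ∈ steinerLevels u f q.1} := by
  have hfm : Measurable f := h.usc.measurable
  have h1 : MeasurableSet {p : (EuclideanSpace ℝ (Fin n) × ℝ) × ℝ |
      p.1.2 ≤ f (p.1.1 - ⟪u, p.1.1⟫ • u + p.2 • u)} :=
    measurableSet_le (by fun_prop) (by fun_prop)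
  have h2 : Measurable fun q : EuclideanSpace ℝ (Fin n) × ℝ =>
      volume.real (fiber u {z | q.2 ≤ f z} (q.1 - ⟪u, q.1⟫ • u)) :=
    (measurable_measure_prodMk_left h1).ennreal_toReal
  have h3 : MeasurableSet {q : EuclideanSpace ℝ (Fin n) × ℝ |
      |⟪u, q.1⟫| ≤ volume.real (fiber u {z | q.2 ≤ f z} (q.1 - ⟪u, q.1⟫ • u)) / 2} :=
    measurableSet_le (by fun_prop) (h2.div_const _)
  convert (h.measurableSet_nonempty_fiber hu).inter h3 using 1
  ext q
  simp only [steinerLevels, mem_ofPred_eq, mem_steiner_iff hu, mem_inter_iff, and_assoc]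

theorem IsAdmissible.norm_le_of_mem_steinerLevels (h : IsAdmissible f M R) (hu : ‖u‖ = 1)
    {x : EuclideanSpace ℝ (Fin n)} {t : ℝ} (ht : t ∈ steinerLevels u f x) :
    t ≤ M ∧ ‖x - ⟪u, x⟫ • u‖ ≤ R := by
  obtain ⟨h0, hx⟩ := ht
  obtain ⟨⟨s, hs⟩, -⟩ := (mem_steiner_iff hu).1 hx
  have hs' : t ≤ f (x - ⟪u, x⟫ • u + s • u) := hs
  refine ⟨hs'.trans (h.le _), ?_⟩
  have hR := h.norm_le _ (h0.trans_le hs')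
  have huu : ⟪u, u⟫ = 1 := by rw [real_inner_self_eq_norm_sq, hu]; norm_num
  have horth : ⟪x - ⟪u, x⟫ • u, s • u⟫ = 0 := by
    rw [inner_smul_right, inner_sub_left, real_inner_smul_left, huu, real_inner_comm]; ring
  have := norm_add_sq_eq_norm_sq_add_norm_sq_of_inner_eq_zero _ _ horth
  refine le_trans ?_ hR
  nlinarith [norm_nonneg (x - ⟪u, x⟫ • u), norm_nonneg (x - ⟪u, x⟫ • u + s • u),
    mul_self_nonneg ‖s • u‖]

theorem IsAdmissible.volume_steinerLevels_le (h : IsAdmissible f M R) (hu : ‖u‖ = 1)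
    (x : EuclideanSpace ℝ (Fin n)) : volume (steinerLevels u f x) ≤ ENNReal.ofReal M := by
  calc volume (steinerLevels u f x) ≤ volume (Ioc 0 M) :=
        measure_mono fun t ht => ⟨ht.1, (h.norm_le_of_mem_steinerLevels hu ht).1⟩
    _ = ENNReal.ofReal M := by simp

theorem IsAdmissible.steinerFun_eq (h : IsAdmissible f M R) (hu : ‖u‖ = 1)
    (x : EuclideanSpace ℝ (Fin n)) : steinerFun u f x = volume.real (steinerLevels u f x) := by
  have hm : MeasurableSet (steinerLevels u f x) :=
    measurable_prodMk_left (h.measurableSet_steinerLevels hu)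
  have e : steinerFun u f x = ∫ t in Ioi (0 : ℝ), (steinerLevels u f x).indicator 1 t := by
    refine setIntegral_congr_fun measurableSet_Ioi fun t ht => ?_
    have ht' : 0 < t := ht
    by_cases hx : x ∈ steiner u {z | t ≤ f z}
    · have : t ∈ steinerLevels u f x := ⟨ht', hx⟩
      simp [hx, this]
    · have : t ∉ steinerLevels u f x := fun hh => hx hh.2
      simp [hx, this]
  rw [e, integral_indicator_one hm, measureReal_def, Measure.restrict_apply hm,
    inter_eq_self_of_subset_left fun t ht => ht.1, measureReal_def]

theorem IsAdmissible.ofReal_steinerFun (h : IsAdmissible f M R) (hu : ‖u‖ = 1)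
    (x : EuclideanSpace ℝ (Fin n)) :
    ENNReal.ofReal (steinerFun u f x) = volume (steinerLevels u f x) := by
  rw [h.steinerFun_eq hu, ofReal_measureReal
    (ne_top_of_le_ne_top ENNReal.ofReal_ne_top (h.volume_steinerLevels_le hu x))]

theorem IsAdmissible.measurable_steinerFun (h : IsAdmissible f M R) (hu : ‖u‖ = 1) :
    Measurable (steinerFun u f) := by
  rw [funext (h.steinerFun_eq hu)]
  exact (measurable_measure_prodMk_left (h.measurableSet_steinerLevels hu)).ennreal_toReal

end Steiner

/-! ### Comparing f with its symmetral fibre by fibre -/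

section Comparison

variable {d : ℕ} {u : EuclideanSpace ℝ (Fin (d + 1))}
  {B : EuclideanSpace ℝ (Fin d) →ₗᵢ[ℝ] EuclideanSpace ℝ (Fin (d + 1))}
  {f : EuclideanSpace ℝ (Fin (d + 1)) → ℝ} {M R : ℝ}

/-- Only the y-component needs a bound, since the graph integral runs over y; this makes the lemma
directly applicable to `steinerFun u f`. -/
theorem graphIntegral_ne_top_of_le {g : EuclideanSpace ℝ (Fin (d + 1)) → ℝ} (hM : ∀ x, g x ≤ M)
    (hR : ∀ (y : EuclideanSpace ℝ (Fin d)) (s : ℝ), R < ‖y‖ → g (B y + s • u) ≤ 0) (w : EuclideanSpace ℝ (Fin d)) :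
    graphIntegral u B g w ≠ ∞ := by
  have hle : graphIntegral u B g w ≤
      ∫⁻ y, (Metric.closedBall (0 : EuclideanSpace ℝ (Fin d)) R).indicator
        (fun _ => ENNReal.ofReal M) y := by
    refine lintegral_mono fun y => ?_
    by_cases hy : y ∈ Metric.closedBall (0 : EuclideanSpace ℝ (Fin d)) R
    · rw [indicator_of_mem hy]
      exact ENNReal.ofReal_le_ofReal (hM _)
    · rw [mem_closedBall_zero_iff, not_le] at hy
      rw [ENNReal.ofReal_of_nonpos (hR y _ hy)]
      exact zero_le
  refine ne_top_of_le_ne_top ?_ hle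
  rw [lintegral_indicator_const Metric.isClosed_closedBall.measurableSet]
  exact ENNReal.mul_ne_top ENNReal.ofReal_ne_top measure_closedBall_lt_top.ne

theorem IsFrame.sub_inner_smul (hB : IsFrame u B) (hu : ‖u‖ = 1) (y : EuclideanSpace ℝ (Fin d))
    (s : ℝ) : B y + s • u - ⟪u, B y + s • u⟫ • u = B y := by
  rw [hB.inner_add_smul hu, add_sub_cancel_right]

theorem IsFrame.norm_sq_eq (hB : IsFrame u B) (hu : ‖u‖ = 1) (y : EuclideanSpace ℝ (Fin d))
    (s : ℝ) : ‖B y + s • u‖ ^ 2 = ‖y‖ ^ 2 + s ^ 2 := by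
  rw [norm_add_sq_real, inner_smul_right, real_inner_comm, hB.inner_eq_zero, B.norm_map, norm_smul,
    hu, mul_one, Real.norm_eq_abs, sq_abs]
  ring

theorem IsAdmissible.graphIntegral_ne_top (h : IsAdmissible f M R) (hB : IsFrame u B)
    (hu : ‖u‖ = 1) (w : EuclideanSpace ℝ (Fin d)) : graphIntegral u B f w ≠ ∞ := by
  refine graphIntegral_ne_top_of_le (R := R) h.le (fun y s hy => ?_) w
  by_contra hpos
  have h1 := h.norm_le _ (not_le.1 hpos)
  have h2 := hB.norm_sq_eq hu y s
  nlinarith [norm_nonneg y, norm_nonneg (B y + s • u), sq_nonneg s]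

theorem IsAdmissible.graphIntegral_steinerFun_ne_top (h : IsAdmissible f M R) (hB : IsFrame u B)
    (hu : ‖u‖ = 1) (w : EuclideanSpace ℝ (Fin d)) :
    graphIntegral u B (steinerFun u f) w ≠ ∞ := by
  refine graphIntegral_ne_top_of_le (R := R) (M := M) (fun x => ?_)
    (fun y s hy => ?_) w
  · rw [h.steinerFun_eq hu]
    exact ENNReal.toReal_le_of_le_ofReal ((h.nonneg 0).trans (h.le 0))
      (h.volume_steinerLevels_le hu x)
  · have hempty : steinerLevels u f (B y + s • u) = ∅ := by
      refine eq_empty_of_forall_notMem fun t ht => ?_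
      have h1 := (h.norm_le_of_mem_steinerLevels hu ht).2
      rw [hB.sub_inner_smul hu, B.norm_map] at h1
      exact absurd h1 (not_le.2 hy)
    rw [h.steinerFun_eq hu, hempty, measureReal_empty]

/-- The layers are the fibres of the superlevel sets. The symmetral keeps endpoints and nonempty
null fibres, so the open centred intervals give only a lower bound, which is all that `LayerPair`
asks. -/
theorem IsAdmissible.layerPair (h : IsAdmissible f M R) (hB : IsFrame u B) (hu : ‖u‖ = 1)
    (y : EuclideanSpace ℝ (Fin d)) :
    LayerPair (fun s => ENNReal.ofReal (f (B y + s • u)))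
      fun s => ENNReal.ofReal (steinerFun u f (B y + s • u)) := by
  have hfm : Measurable f := h.usc.measurable
  refine ⟨fun t => fiber u {z | t ≤ f z} (B y), ?_, ?_, ?_, ?_⟩
  · exact measurableSet_le (f := fun p : ℝ × ℝ => p.1)
      (g := fun p : ℝ × ℝ => f (B y + p.2 • u)) (by fun_prop) (by fun_prop)
  · intro t ht
    have hsub : fiber u {z | t ≤ f z} (B y) ⊆ Icc (-R) R := by
      intro s hs
      have hs' : t ≤ f (B y + s • u) := hs
      have h1 := h.norm_le _ (lt_of_lt_of_le ht hs')
      have h2 := hB.norm_sq_eq hu y s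
      rw [mem_Icc, ← abs_le]
      have h3 : |s| ^ 2 ≤ ‖B y + s • u‖ ^ 2 := by rw [sq_abs, h2]; nlinarith [sq_nonneg ‖y‖]
      exact (abs_le_of_sq_le_sq' h3 (norm_nonneg _)).2.trans h1
    exact ne_top_of_le_ne_top (by simp) (measure_mono hsub)
  · intro s
    have e : ∀ t : ℝ, (fiber u {z | t ≤ f z} (B y)).indicator (1 : ℝ → ℝ≥0∞) s =
        (Iic (f (B y + s • u))).indicator 1 t := by
      intro t
      by_cases ht : t ≤ f (B y + s • u)
      · rw [indicator_of_mem (show s ∈ fiber u {z | t ≤ f z} (B y) from ht),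
          indicator_of_mem (show t ∈ Iic _ from ht)]
        rfl
      · rw [indicator_of_notMem (show s ∉ fiber u {z | t ≤ f z} (B y) from ht),
          indicator_of_notMem (show t ∉ Iic _ from ht)]
    simp_rw [e]
    rw [lintegral_indicator_one measurableSet_Iic, Measure.restrict_apply measurableSet_Iic,
      Iic_inter_Ioi, Real.volume_Ioc, sub_zero]
  · intro s
    have hm : MeasurableSet (steinerLevels u f (B y + s • u)) :=
      measurable_prodMk_left (h.measurableSet_steinerLevels hu)
    have e : volume (steinerLevels u f (B y + s • u)) =
        ∫⁻ t in Ioi (0 : ℝ), (steinerLevels u f (B y + s • u)).indicator 1 t := by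
      rw [lintegral_indicator_one hm, Measure.restrict_apply hm,
        inter_eq_self_of_subset_left fun t ht => ht.1]
    beta_reduce
    rw [h.ofReal_steinerFun hu, e]
    refine setLIntegral_mono' measurableSet_Ioi fun t ht => ?_
    by_cases hs : s ∈ centred (volume.real (fiber u {z | t ≤ f z} (B y)))
    · have hmem : t ∈ steinerLevels u f (B y + s • u) := by
        refine ⟨ht, (mem_steiner_iff hu).2 ?_⟩
        rw [hB.sub_inner_smul hu, hB.inner_add_smul hu]
        have habs := abs_lt.2 hs
        refine ⟨?_, habs.le⟩
        -- An empty fibre has length 0, and then |s| < 0.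
        by_contra hne
        rw [not_nonempty_iff_eq_empty] at hne
        rw [hne] at habs
        simp only [measureReal_empty, zero_div] at habs
        exact absurd habs (not_lt.2 (abs_nonneg s))
      rw [indicator_of_mem hs, indicator_of_mem hmem]
      rfl
    · rw [indicator_of_notMem hs]
      exact zero_le

theorem lintegral_graphIntegral_pow {g : EuclideanSpace ℝ (Fin (d + 1)) → ℝ} (hg : Measurable g)
    (k : ℕ) :
    ∫⁻ w, graphIntegral u B g w ^ k = ∫⁻ w : Fin d → ℝ,
      (∫⁻ y : Fin d → ℝ, ENNReal.ofReal (g (B (WithLp.toLp 2 y) + (w ⬝ᵥ y) • u))) ^ k := by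
  have hBm : Measurable B := B.continuous.measurable
  rw [← (PiLp.volume_preserving_toLp (Fin d)).lintegral_comp
    ((measurable_graphIntegral hg).pow_const k)]
  refine lintegral_congr fun w => ?_
  rw [graphIntegral, ← (PiLp.volume_preserving_toLp (Fin d)).lintegral_comp (by fun_prop)]
  congr 1
  refine lintegral_congr fun y => ?_
  rw [EuclideanSpace.inner_toLp_toLp, star_trivial, dotProduct_comm]

end Comparison

theorem IsAdmissible.volume_intersectionBodyFun_le {m : ℕ} {u : EuclideanSpace ℝ (Fin (m + 2))}
    {f : EuclideanSpace ℝ (Fin (m + 2)) → ℝ} {M R : ℝ} (h : IsAdmissible f M R) (hu : ‖u‖ = 1) :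
    volume (intersectionBodyFun f) ≤ volume (intersectionBodyFun (steinerFun u f)) := by
  obtain ⟨B, hB⟩ := exists_isFrame hu
  have hBm : Measurable B := B.continuous.measurable
  have hf : Measurable f := h.usc.measurable
  have hS := h.measurable_steinerFun hu
  rw [hB.volume_intersectionBodyFun hu hf h.nonneg (h.graphIntegral_ne_top hB hu),
    hB.volume_intersectionBodyFun hu hS
      (fun x => by rw [h.steinerFun_eq hu]; exact measureReal_nonneg)
      (h.graphIntegral_steinerFun_ne_top hB hu),
    lintegral_graphIntegral_pow hf, lintegral_graphIntegral_pow hS]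
  refine mul_le_mul_right ?_ _
  exact lintegral_pow_le
    (Φ := fun y s => ENNReal.ofReal (f (B (WithLp.toLp 2 y) + s • u)))
    (Φ' := fun y s => ENNReal.ofReal (steinerFun u f (B (WithLp.toLp 2 y) + s • u)))
    (by unfold Function.uncurry; fun_prop) (by unfold Function.uncurry; fun_prop)
    fun y => h.layerPair hB hu _

/-! ### Compact sets as indicator functions -/

section Indicator

variable {n : ℕ} {u : EuclideanSpace ℝ (Fin n)}

theorem intersectionBody_eq {K : Set (EuclideanSpace ℝ (Fin n))} (hK : MeasurableSet K) :
    intersectionBody K = intersectionBodyFun (K.indicator 1) := by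
  unfold intersectionBody intersectionBodyFun
  congr 1 with θ
  rw [integral_indicator_one hK, measureReal_def, Measure.restrict_apply hK]

theorem isAdmissible_indicator {K : Set (EuclideanSpace ℝ (Fin n))} (hK : IsCompact K) :
    ∃ M R, IsAdmissible (K.indicator (1 : EuclideanSpace ℝ (Fin n) → ℝ)) M R := by
  refine exists_isAdmissible (fun x => indicator_nonneg (fun _ _ => zero_le_one) x)
    (hK.isClosed.upperSemicontinuous_indicator zero_le_one) ?_
  exact HasCompactSupport.intro hK fun x hx => indicator_of_notMem hx _

/-- The superlevel sets of 1_K are K for 0 < t ≤ 1 and empty for t > 1, and the symmetral of the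
empty set is empty. -/
theorem steinerFun_indicator (hu : ‖u‖ = 1) {K : Set (EuclideanSpace ℝ (Fin n))}
    (hK : IsCompact K) : steinerFun u (K.indicator 1) = (steiner u K).indicator 1 := by
  obtain ⟨M, R, h⟩ := isAdmissible_indicator hK
  ext x
  rw [h.steinerFun_eq hu]
  have hset : ∀ t : ℝ, 0 < t → {z | t ≤ K.indicator (1 : EuclideanSpace ℝ (Fin n) → ℝ) z} =
      if t ≤ 1 then K else ∅ := by
    intro t ht
    ext z
    by_cases hz : z ∈ K <;> by_cases h1 : t ≤ 1 <;> simp [hz, h1, ht]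
  have hempty : x ∉ steiner u (∅ : Set (EuclideanSpace ℝ (Fin n))) := by
    rintro ⟨y, -, ⟨s, hs⟩, -⟩
    exact hs
  have hlev : steinerLevels u (K.indicator 1) x = {t | t ∈ Ioc (0 : ℝ) 1 ∧ x ∈ steiner u K} := by
    ext t
    by_cases ht : 0 < t
    · simp only [steinerLevels, mem_ofPred_eq, hset t ht, ht, true_and, mem_Ioc]
      by_cases h1 : t ≤ 1 <;> simp [h1, hempty]
    · simp [steinerLevels, ht]
  rw [hlev]
  by_cases hx : x ∈ steiner u K
  · simp only [hx, and_true, indicator_of_mem, Pi.one_apply]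
    change volume.real (Ioc (0 : ℝ) 1) = 1
    simp
  · simp [hx]

theorem measurableSet_steiner (hu : ‖u‖ = 1) {K : Set (EuclideanSpace ℝ (Fin n))}
    (hK : IsCompact K) : MeasurableSet (steiner u K) := by
  obtain ⟨M, R, h⟩ := isAdmissible_indicator hK
  have hm := h.measurable_steinerFun hu
  rw [steinerFun_indicator hu hK] at hm
  convert hm (measurableSet_singleton 1) using 1
  ext x
  by_cases hx : x ∈ steiner u K <;> simp [hx]

end Indicator

end BusemannSteiner

end

theorem corollary1p8 (n : ℕ) (hn : 2 ≤ n)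
    (u : EuclideanSpace ℝ (Fin n)) (hu : ‖u‖ = 1) :
    (∀ f : EuclideanSpace ℝ (Fin n) → ℝ,
      (∀ x, 0 ≤ f x) → UpperSemicontinuous f → HasCompactSupport f →
        volume (BusemannSteiner.intersectionBodyFun f) ≤
          volume (BusemannSteiner.intersectionBodyFun (BusemannSteiner.steinerFun u f))) ∧
    (∀ K : Set (EuclideanSpace ℝ (Fin n)), IsCompact K →
        volume (BusemannSteiner.intersectionBody K) ≤
          volume (BusemannSteiner.intersectionBody (BusemannSteiner.steiner u K))) := by
  -- With n = m + 2 the graphs have m + 1 ≥ 1 parameters, so the rearrangement inequality has a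
  -- first variable to split off.
  obtain ⟨m, rfl⟩ := Nat.exists_eq_add_of_le' hn
  refine ⟨fun f h0 hf hc => ?_, fun K hK => ?_⟩
  · obtain ⟨M, R, h⟩ := BusemannSteiner.exists_isAdmissible h0 hf hc
    exact h.volume_intersectionBodyFun_le hu
  · obtain ⟨M, R, h⟩ := BusemannSteiner.isAdmissible_indicator hK
    rw [BusemannSteiner.intersectionBody_eq hK.measurableSet,
      BusemannSteiner.intersectionBody_eq (BusemannSteiner.measurableSet_steiner hu hK),
      ← BusemannSteiner.steinerFun_indicator hu hK]
    exact h.volume_intersectionBodyFun_le hu
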